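/- Let $N\ge 2$ and $k\ge 1$. A codimension one $k$-web $\mathcal W$ on the complex projective space $\mathbb P^N$ is given by a Zariski-open covering $\{U_i\}$ of $\mathbb P^N$ by non-empty open sets and $k$-symmetric $1$-forms $\omega_i\in \mathrm{Sym}^k\Omega^1_{\mathbb P^N}(U_i)$ such that (1) on each $U_i\cap U_j$ one has $\omega_i=g_{ij}\,\omega_j$ with a nowhere vanishing regular function $g_{ij}$; (2) the zero set of each $\omega_i$ has codimension at least two; (3) for generic $x\in U_i$, $\omega_i$ at $x$, seen as a homogeneous polynomial of degree $k$ on the tangent space at $x$, is square-free; (4) for generic $x\in U_i$, the germ of $\omega_i$ at $x$ is a product $\beta_1\cdots\beta_k$ of germs of holomorphic $1$-forms with $\beta_j\wedge d\beta_j=0$ for all $j$. Let $\omega$ be the twisted $k$-symmetric $1$-form defined by the $\omega_i$. The degree $d$ of $\mathcal W$ is the degree of the zero divisor of $\iota^*\omega$ on $\mathbb P^1$, where $\iota:\mathbb P^1\hookrightarrow\mathbb P^N$ is a generic linear embedding. The group $\mathrm{Aut}(\mathcal W)$ consists of all $T\in\mathrm{Aut}(\mathbb P^N)=\mathrm{PGL}_{N+1}(\mathbb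 C)$ such that $T^*\omega$ defines the same web, that is, $T^*\omega_j$ and $\omega_i$ differ by a nowhere vanishing regular function on $U_i\cap T^{-1}(U_j)$ for all $i,j$. Let $\mathcal W$ be a codimension one $k$-web of degree $d$ on $\mathbb P^N$ such that $\mathrm{Aut}(\mathcal W)$ is finite. Then $$|\mathrm{Aut}(\mathcal W)|\le (d+2k)^{(N+1)^2-1}.$$ -/

import Mathlib

open scoped LinearAlgebra.Projectivization Topology

noncomputable section

namespace ProjWeb

/-- The vector space `ℂ^(N+1)` of homogeneous coordinates. -/
abbrev Vec (N : ℕ) : Type := Fin (N + 1) → ℂ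

/-- The (closed points of the) complex projective space `ℙ^N`. -/
abbrev PN (N : ℕ) : Type := ℙ ℂ (Vec N)

/-- The point `[x]` of `ℙ^N`. -/
abbrev pt {N : ℕ} (x : Vec N) (hx : x ≠ 0) : PN N := Projectivization.mk ℂ x hx

/-- Homogeneous-coordinate polynomials. -/
abbrev Poly (N : ℕ) : Type := MvPolynomial (Fin (N + 1)) ℂ

/-- Zariski-open subsets of `ℙ^N`: the complements of the common zero sets of families of
homogeneous polynomials. -/
def IsZariskiOpen {N : ℕ} (U : Set (PN N)) : Prop :=
  ∃ S : Set (Poly N), (∀ F ∈ S, ∃ e : ℕ, F.IsHomogeneous e) ∧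
    ∀ (x : Vec N) (hx : x ≠ 0), pt x hx ∈ U ↔ ∃ F ∈ S, MvPolynomial.eval x F ≠ 0

/-- `P` holds at a generic point of `U`: it holds on a non-empty Zariski-open subset of `U`
(which is automatically dense, as `ℙ^N` is irreducible).  The property is one of a
representative `x` of the point `[x]`. -/
def Generically {N : ℕ} (U : Set (PN N)) (P : Vec N → Prop) : Prop :=
  ∃ O : Set (PN N), IsZariskiOpen O ∧ O.Nonempty ∧ O ⊆ U ∧
    ∀ (x : Vec N) (hx : x ≠ 0), pt x hx ∈ O → P x

/-- `k`-symmetric `1`-forms on a Zariski-open `U ⊆ ℙ^N`, i.e. sections of `Sym^k Ω¹` over `U`.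

The tangent space of `ℙ^N` at `[x]` is `ℂ^(N+1) / ℂ x`, and the pairs `(x, v)` and
`(c x, c v)` with `c ≠ 0` represent the same tangent vector.  A section of `Sym^k Ω¹` is a
regular function on the tangent bundle over `U` which is a homogeneous polynomial of degree `k`
on each tangent space.  Thus it is a family of homogeneous polynomials `η x` of degree `k` in
the variables `v_0, …, v_N` (that is, in `dx_0, …, dx_N`), for `x` over `U`, such that
`η x (v)` depends only on the tangent vector represented by `(x, v)`, and whose coefficients
are, locally on `U`, quotients of polynomials in `x`.  The values of `η` at the vectors that do
not lie over `U` are irrelevant. -/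
structure IsSymForm {N : ℕ} (k : ℕ) (U : Set (PN N)) (η : Vec N → Poly N) : Prop where
  homogeneous : ∀ (x : Vec N) (hx : x ≠ 0), pt x hx ∈ U → (η x).IsHomogeneous k
  radial : ∀ (x : Vec N) (hx : x ≠ 0), pt x hx ∈ U → ∀ (c : ℂ) (v : Vec N),
    MvPolynomial.eval (v + c • x) (η x) = MvPolynomial.eval v (η x)
  scale : ∀ (x : Vec N) (hx : x ≠ 0), pt x hx ∈ U → ∀ (c : ℂ), c ≠ 0 → ∀ v : Vec N,
    MvPolynomial.eval (c • v) (η (c • x)) = MvPolynomial.eval v (η x)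
  regular : ∀ (x : Vec N) (hx : x ≠ 0), pt x hx ∈ U →
    ∃ (e : ℕ) (Q : Poly N) (P : MvPolynomial (Fin (N + 1)) (Poly N)),
      Q.IsHomogeneous e ∧ MvPolynomial.eval x Q ≠ 0 ∧
      ∀ (y : Vec N) (hy : y ≠ 0), pt y hy ∈ U → MvPolynomial.eval y Q ≠ 0 →
        MvPolynomial.C (MvPolynomial.eval y Q) * η y =
          MvPolynomial.map (MvPolynomial.eval y) P

/-- `η = g θ` over `U` for a nowhere vanishing regular function `g`.  Near each point of `U`,
`g` is a quotient `F / G` of homogeneous polynomials of the same degree, without zeros there.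
(When `θ` vanishes on no non-empty open set, the local functions `g` are unique, so they glue
to a function in `𝒪*(U)`.) -/
def AgreeUpToUnit {N : ℕ} (U : Set (PN N)) (η θ : Vec N → Poly N) : Prop :=
  ∀ (x : Vec N) (hx : x ≠ 0), pt x hx ∈ U →
    ∃ (e : ℕ) (F G : Poly N), F.IsHomogeneous e ∧ G.IsHomogeneous e ∧
      MvPolynomial.eval x F ≠ 0 ∧ MvPolynomial.eval x G ≠ 0 ∧
      ∀ (y : Vec N) (hy : y ≠ 0), pt y hy ∈ U →
        MvPolynomial.eval y F ≠ 0 → MvPolynomial.eval y G ≠ 0 →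
        MvPolynomial.C (MvPolynomial.eval y G) * η y =
          MvPolynomial.C (MvPolynomial.eval y F) * θ y

/-- The zero set of the form `η` on `U` has codimension at least two: it contains no
hypersurface of `U`, i.e. no non-empty set `{F = 0} ∩ U` with `F` irreducible homogeneous. -/
def ZeroCodimAtLeastTwo {N : ℕ} (U : Set (PN N)) (η : Vec N → Poly N) : Prop :=
  ∀ (F : Poly N) (e : ℕ), F.IsHomogeneous e → Irreducible F →
    (∃ (x : Vec N) (hx : x ≠ 0), pt x hx ∈ U ∧ MvPolynomial.eval x F = 0) →
    ∃ (x : Vec N) (hx : x ≠ 0), pt x hx ∈ U ∧ MvPolynomial.eval x F = 0 ∧ η x ≠ 0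

/-- The germ at `[x]` of a holomorphic `1`-form on `ℙ^N`, given by its pull-back `β` to
`ℂ^(N+1)`: a holomorphic germ of `1`-form at `x` which annihilates the radial direction and is
invariant under scaling. -/
def IsOneFormGerm {N : ℕ} (x : Vec N) (β : Vec N → (Vec N →L[ℂ] ℂ)) : Prop :=
  AnalyticAt ℂ β x ∧ (∀ᶠ y in 𝓝 x, β y y = 0) ∧
    ∀ᶠ y in 𝓝 x, ∀ᶠ c in 𝓝 (1 : ℂ), ∀ v : Vec N, β (c • y) (c • v) = β y v

/-- The exterior derivative `dβ` of a `1`-form at `y`, on the vectors `u`, `v`. -/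
def extD {N : ℕ} (β : Vec N → (Vec N →L[ℂ] ℂ)) (y u v : Vec N) : ℂ :=
  fderiv ℂ β y u v - fderiv ℂ β y v u

/-- The integrability condition `β ∧ dβ = 0`, near `x`. -/
def IsIntegrableAt {N : ℕ} (x : Vec N) (β : Vec N → (Vec N →L[ℂ] ℂ)) : Prop :=
  ∀ᶠ y in 𝓝 x, ∀ u v w : Vec N,
    β y u * extD β y v w + β y v * extD β y w u + β y w * extD β y u v = 0

/-- The germ of `η` at `[x]` is the product of `k` germs of integrable holomorphic `1`-forms. -/
def DecomposesAt {N : ℕ} (k : ℕ) (η : Vec N → Poly N) (x : Vec N) : Prop :=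
  ∃ β : Fin k → Vec N → (Vec N →L[ℂ] ℂ),
    (∀ j, IsOneFormGerm x (β j)) ∧ (∀ j, IsIntegrableAt x (β j)) ∧
    ∀ᶠ y in 𝓝 x, ∀ v : Vec N, MvPolynomial.eval v (η y) = ∏ j, β j y v

/-- (A presentation of) a codimension one `k`-web on `ℙ^N`: a covering by non-empty open sets
`U i` with `k`-symmetric `1`-forms `ω i` on them, which agree up to units on the overlaps, have
zero sets of codimension at least two, and are generically square-free and a product of
integrable `1`-forms.  Square-freeness at `[x]` is tested on the polynomial `η x` on
`ℂ^(N+1)`, which is the composite of a polynomial on the tangent space `ℂ^(N+1) / ℂ x` with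
the projection, and is square-free exactly when that polynomial is. -/
structure CodimOneWeb (N k : ℕ) where
  ι : Type
  U : ι → Set (PN N)
  isOpen : ∀ i, IsZariskiOpen (U i)
  nonempty : ∀ i, (U i).Nonempty
  covers : ∀ p : PN N, ∃ i, p ∈ U i
  ω : ι → Vec N → Poly N
  isForm : ∀ i, IsSymForm k (U i) (ω i)
  compatible : ∀ i j, AgreeUpToUnit (U i ∩ U j) (ω i) (ω j)
  codim : ∀ i, ZeroCodimAtLeastTwo (U i) (ω i)
  squarefree : ∀ i, Generically (U i) fun x => Squarefree (ω i x)
  decomposes : ∀ i, Generically (U i) (DecomposesAt k (ω i))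

/-- The linear map `ℂ² → ℂ^(N+1)` with columns `a`, `b`; for linearly independent `a`, `b` it
induces the linear embedding of `ℙ¹` onto the line through `[a]` and `[b]`. -/
def lineMap {N : ℕ} (a b : Vec N) (z : Fin 2 → ℂ) : Vec N := z 0 • a + z 1 • b

/-- `D` is the zero divisor, on `ℙ¹`, of the restriction `i^*ω` of the twisted form defining `W`
to the line through `[a]` and `[b]`.  Near the point `[z]` of `ℙ¹`, with local parameter
`t ↦ [z + t z']` (for `z'` independent of `z`), the restriction of `ω i` is
`ω i (q + t r) (r) (dt)^k`, where `q`, `r` are the images of `z`, `z'`; the multiplicity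
of `[z]` in `D` is the order of vanishing of this function at `t = 0`. -/
def IsTangencyDivisor {N k : ℕ} (W : CodimOneWeb N k) (a b : Vec N)
    (D : ℙ ℂ (Fin 2 → ℂ) →₀ ℕ) : Prop :=
  ∀ (z z' : Fin 2 → ℂ) (hz : z ≠ 0), LinearIndependent ℂ ![z, z'] →
    ∀ (i : W.ι) (hq : lineMap a b z ≠ 0), pt (lineMap a b z) hq ∈ W.U i →
      analyticOrderAt (fun t : ℂ => MvPolynomial.eval (lineMap a b z')
        (W.ω i (lineMap a b z + t • lineMap a b z'))) 0 =
        (D (Projectivization.mk ℂ z hz) : ℕ∞)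

/-- `W` has degree `d`: for a generic line in `ℙ^N`, the tangency divisor of `W` with the line
has degree `d`.  Generic lines are the ones through `[a]` and `[b]` for `(a, b)` in a
non-empty Zariski-open set. -/
def CodimOneWeb.HasDegree {N k : ℕ} (W : CodimOneWeb N k) (d : ℕ) : Prop :=
  ∃ R : MvPolynomial (Fin (N + 1) ⊕ Fin (N + 1)) ℂ, R ≠ 0 ∧
    ∀ a b : Vec N, LinearIndependent ℂ ![a, b] →
      MvPolynomial.eval (Sum.elim a b) R ≠ 0 →
      ∃ D : ℙ ℂ (Fin 2 → ℂ) →₀ ℕ, IsTangencyDivisor W a b D ∧ (D.sum fun _ m => m) = d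

/-- Linear substitution `F ↦ F ∘ A` on polynomials. -/
def subst {N : ℕ} (A : GL (Fin (N + 1)) ℂ) (F : Poly N) : Poly N :=
  MvPolynomial.bind₁ (fun i => ∑ j, MvPolynomial.C (A i j) * MvPolynomial.X j) F

/-- The pull-back `A^*η`, `(A^*η)(x)(v) = η (A x) (A v)`, by the automorphism `[x] ↦ [A x]`. -/
def pullback {N : ℕ} (A : GL (Fin (N + 1)) ℂ) (η : Vec N → Poly N) (x : Vec N) : Poly N :=
  subst A (η (A • x))

theorem eval_subst {N : ℕ} (A : GL (Fin (N + 1)) ℂ) (F : Poly N) (v : Vec N) :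
    MvPolynomial.eval v (subst A F) = MvPolynomial.eval (A • v) F := by
  have h : (A • v : Vec N) = fun i => ∑ j, A i j * v j := by
    funext i; rfl
  rw [h]
  unfold subst
  induction F using MvPolynomial.induction_on with
  | C a => simp
  | add p q hp hq => simp [hp, hq]
  | mul_X p i hp => simp [hp]

theorem subst_isHomogeneous {N : ℕ} (A : GL (Fin (N + 1)) ℂ) {F : Poly N} {e : ℕ}
    (hF : F.IsHomogeneous e) : (subst A F).IsHomogeneous e := by
  have := hF.aeval (fun i => ∑ j, MvPolynomial.C (A i j) * MvPolynomial.X j) (n := 1)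
    (fun i => MvPolynomial.IsHomogeneous.sum _ _ _ fun j _ => by
      simpa using (MvPolynomial.isHomogeneous_C (Fin (N + 1)) (A i j)).mul
        (MvPolynomial.isHomogeneous_X ℂ j))
  simpa [subst, MvPolynomial.aeval_eq_bind₁] using this

theorem eval_pullback {N : ℕ} (A : GL (Fin (N + 1)) ℂ) (η : Vec N → Poly N) (x v : Vec N) :
    MvPolynomial.eval v (pullback A η x) = MvPolynomial.eval (A • v) (η (A • x)) :=
  eval_subst A _ v

/-- The automorphism of `ℙ^N` induced by `A` preserves `W`: the pull-backs of the forms defining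
`W` define the same web, i.e. agree with those forms up to units wherever both are defined. -/
def CodimOneWeb.Preserves {N k : ℕ} (W : CodimOneWeb N k) (A : GL (Fin (N + 1)) ℂ) : Prop :=
  ∀ i j, AgreeUpToUnit {p : PN N | p ∈ W.U i ∧ A • p ∈ W.U j} (pullback A (W.ω j)) (W.ω i)

theorem CodimOneWeb.Preserves.one {N k : ℕ} (W : CodimOneWeb N k) : W.Preserves 1 := by
  intro i j x hx hxU
  obtain ⟨e, F, G, hF, hG, hFx, hGx, h⟩ :=
    W.compatible j i x hx ⟨by simpa using hxU.2, hxU.1⟩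
  refine ⟨e, F, G, hF, hG, hFx, hGx, fun y hy hyU hFy hGy => ?_⟩
  rw [← h y hy ⟨by simpa using hyU.2, hyU.1⟩ hFy hGy]
  congr 1
  apply MvPolynomial.funext
  intro v
  simp [eval_pullback]

theorem CodimOneWeb.Preserves.mul {N k : ℕ} {W : CodimOneWeb N k} {A B : GL (Fin (N + 1)) ℂ}
    (hA : W.Preserves A) (hB : W.Preserves B) : W.Preserves (A * B) := by
  intro i l x hx hxU
  have hBx : B • x ≠ 0 := (smul_ne_zero_iff_ne B).2 hx
  obtain ⟨j, hj⟩ := W.covers (pt (B • x) hBx)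
  have hABx : A • pt (B • x) hBx ∈ W.U l := by
    have := hxU.2
    rw [mul_smul] at this
    exact this
  obtain ⟨S, hS, hSU⟩ := W.isOpen j
  obtain ⟨H, hHS, hHx⟩ := (hSU _ hBx).1 hj
  obtain ⟨h, hH⟩ := hS H hHS
  obtain ⟨e, F, G, hF, hG, hFx, hGx, h1⟩ := hB i j x hx ⟨hxU.1, hj⟩
  obtain ⟨e', F', G', hF', hG', hFx', hGx', h2⟩ := hA j l _ hBx ⟨hj, hABx⟩
  refine ⟨e + e' + h, F * subst B F' * subst B H, G * subst B G' * subst B H,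
    (hF.mul (subst_isHomogeneous B hF')).mul (subst_isHomogeneous B hH),
    (hG.mul (subst_isHomogeneous B hG')).mul (subst_isHomogeneous B hH), ?_, ?_, ?_⟩
  · simp only [map_mul, eval_subst]
    exact mul_ne_zero (mul_ne_zero hFx hFx') hHx
  · simp only [map_mul, eval_subst]
    exact mul_ne_zero (mul_ne_zero hGx hGx') hHx
  · intro y hy hyU hFy hGy
    simp only [map_mul, eval_subst, ne_eq, mul_eq_zero, not_or] at hFy hGy
    have hBy : B • y ≠ 0 := (smul_ne_zero_iff_ne B).2 hy
    have hyj : pt (B • y) hBy ∈ W.U j := (hSU _ hBy).2 ⟨H, hHS, hFy.2⟩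
    have hABy : A • pt (B • y) hBy ∈ W.U l := by
      have := hyU.2
      rw [mul_smul] at this
      exact this
    have e1 := h1 y hy ⟨hyU.1, hyj⟩ hFy.1.1 hGy.1.1
    have e2 := h2 _ hBy ⟨hyj, hABy⟩ hFy.1.2 hGy.1.2
    apply MvPolynomial.funext
    intro v
    have e1v := congrArg (MvPolynomial.eval v) e1
    have e2v := congrArg (MvPolynomial.eval (B • v)) e2
    simp only [map_mul, MvPolynomial.eval_C, eval_pullback, eval_subst, mul_smul] at e1v e2v ⊢
    linear_combination
      MvPolynomial.eval y G * MvPolynomial.eval (B • y) H * e2v +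
      MvPolynomial.eval (B • y) F' * MvPolynomial.eval (B • y) H * e1v

theorem CodimOneWeb.Preserves.inv {N k : ℕ} {W : CodimOneWeb N k} {A : GL (Fin (N + 1)) ℂ}
    (hA : W.Preserves A) : W.Preserves A⁻¹ := by
  intro i j x hx hxU
  have hAx : A⁻¹ • x ≠ 0 := (smul_ne_zero_iff_ne A⁻¹).2 hx
  have key : ∀ (y : Vec N) (hy : y ≠ 0) (hAy : A⁻¹ • y ≠ 0),
      A • pt (A⁻¹ • y) hAy = pt y hy := by
    intro y hy hAy
    rw [Projectivization.smul_mk]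
    congr 1
    simp
  obtain ⟨e, F, G, hF, hG, hFx, hGx, h⟩ := hA j i _ hAx
    ⟨hxU.2, by rw [key x hx]; exact hxU.1⟩
  refine ⟨e, subst A⁻¹ G, subst A⁻¹ F, subst_isHomogeneous _ hG, subst_isHomogeneous _ hF,
    by rwa [eval_subst], by rwa [eval_subst], fun y hy hyU hGy hFy => ?_⟩
  rw [eval_subst] at hGy hFy
  have hAy : A⁻¹ • y ≠ 0 := (smul_ne_zero_iff_ne A⁻¹).2 hy
  have e1 := h _ hAy ⟨hyU.2, by rw [key y hy]; exact hyU.1⟩ hFy hGy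
  apply MvPolynomial.funext
  intro v
  have e1v := congrArg (MvPolynomial.eval (A⁻¹ • v)) e1
  simp only [map_mul, MvPolynomial.eval_C, eval_pullback, eval_subst, smul_inv_smul] at e1v ⊢
  exact e1v.symm

/-- The group of the matrices in `GL (N+1, ℂ)` which preserve `W`. -/
def CodimOneWeb.linearGroup {N k : ℕ} (W : CodimOneWeb N k) : Subgroup (GL (Fin (N + 1)) ℂ) where
  carrier := {A | W.Preserves A}
  mul_mem' := fun hA hB => hA.mul hB
  one_mem' := CodimOneWeb.Preserves.one W
  inv_mem' := fun hA => hA.inv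

/-- `Aut(W)`, the group of the elements of `Aut(ℙ^N) = PGL (N+1, ℂ)` which preserve `W`. -/
def CodimOneWeb.autGroup {N k : ℕ} (W : CodimOneWeb N k) :
    Subgroup (Matrix.ProjGenLinGroup (Fin (N + 1)) ℂ) :=
  W.linearGroup.map Matrix.ProjGenLinGroup.mk

end ProjWeb

end

/-!
The forms defining the web glue to one form `Ω(x, v)` on `ℂ^(N+1)` with polynomial coefficients
without common factor, homogeneous of degree `δ` in `x` and `k` in `v`. Such an `Ω` exists because
polynomial rings are factorial: each `ω i` is locally a rational multiple of `Ω`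
(`CodimOneWeb.exists_eq_C_mul`), and the multiple has neither poles nor zeros because `ω i` is
regular and its zero set has codimension at least two (`CodimOneWeb.exists_globalForm`).
Restricting `Ω` to a generic line gives a polynomial of degree `δ - k` in the affine coordinate,
so `δ = d + k` (`IsGlobalForm.degree_eq`).

A matrix `A` preserves the web if and only if `Ω(Ax, Av) = c Ω(x, v)` for a nonzero constant `c`.
After rescaling by a root of `c`, every automorphism of the web comes from a matrix `M` with
`Ω(Mx, Mv) = Ω(x, v)`, unique up to a `D`-th root of unity, where `D = δ + k = d + 2k`.
Conversely, all matrices with this property are invertible: if `M u = 0` with `u ≠ 0`, then `Ω` is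
invariant under translation of both arguments along `u`, and the maps `x ↦ x + n l(x) u` with
`l(u) = 0` are infinitely many automorphisms. Hence the set of these matrices is finite with `D
|Aut(W)|` elements (`IsGlobalForm.nonempty_prod_equiv_stabilizer`). It is the zero set of
polynomials of degree at most `D` in the `(N+1)^2` entries of `M`, so by an affine Bézout
inequality it has at most `D ^ (N+1)^2` elements; dividing by `D` gives the bound.

The Bézout inequality (`ncard_common_zeros_le`) says that a finite set of common zeros in affine
`m`-space of polynomials of degree at most `D` has at most `D ^ m` points, however many the
polynomials are and whatever happens at infinity. First `m` generic linear combinations `g` of the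
polynomials are chosen for which the points `p i` are still isolated zeros. If `e i` are
polynomials with `e i (p j) = δ_ij`, then a relation `∑ c_i(g) e_i = 0` with polynomials `c_i` is
trivial: one restricts it to the inverse image under `g` of a generic line through the origin,
which by Krull's height theorem contains a curve through each `p i`, divides by the largest power
of the line's parameter that occurs in all `c_i`, and evaluates at a `p i`. Comparing the
dimension of the space of the `∑ c_i(g) e_i` with `deg c_i ≤ r` to that of all polynomials of
degree at most `r D + E`, as `r → ∞`, bounds the number of points by `D ^ m`.
-/

/-! ### Heights of ideals and isolated zeros -/

open MvPolynomial in
/-- The height of the ideal of a point is the dimension of the affine space. All these heights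
agree because of translations, and their supremum is the Krull dimension of the ring. -/
theorem height_vanishingIdeal_singleton {K σ : Type*} [Field K] [IsAlgClosed K] [Finite σ]
    (p : σ → K) : (vanishingIdeal K ({p} : Set (σ → K))).height = Nat.card σ := by
  have key : ∀ p q : σ → K, (vanishingIdeal K ({p} : Set (σ → K))).height ≤
      (vanishingIdeal K ({q} : Set (σ → K))).height := by
    intro p q
    let φ : (σ → K) → MvPolynomial σ K →ₐ[K] MvPolynomial σ K := fun c =>
      aeval fun i => X i + C (c i)
    have hφ : ∀ c d : σ → K, c + d = 0 → (φ c).comp (φ d) = AlgHom.id K _ := by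
      intro c d h
      ext1 i
      have := congrFun h i
      simp only [Pi.add_apply, Pi.zero_apply] at this
      simp [φ, add_assoc, ← C_add, this]
    let e : MvPolynomial σ K ≃ₐ[K] MvPolynomial σ K :=
      AlgEquiv.ofAlgHom (φ (q - p)) (φ (p - q)) (hφ _ _ (by simp)) (hφ _ _ (by simp))
    rw [← RingEquiv.height_comap e.toRingEquiv (vanishingIdeal K ({p} : Set (σ → K)))]
    apply le_of_eq
    congr 1
    ext f
    have : (aeval p : MvPolynomial σ K →ₐ[K] K).comp (φ (q - p)) = aeval q := by
      ext1 i
      simp [φ]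
    have h2 := congrArg (fun g => g f) this
    simp only [AlgHom.comp_apply] at h2
    rw [mem_vanishingIdeal_singleton_iff, ← h2, Ideal.mem_comap, mem_vanishingIdeal_singleton_iff]
    rfl
  have hdim : ringKrullDim (MvPolynomial σ K) = Nat.card σ := by
    rw [MvPolynomial.ringKrullDim_of_isNoetherianRing, ringKrullDim_eq_zero_of_field, zero_add]
  apply le_antisymm
  · have := Ideal.height_le_ringKrullDim_of_ne_top
      (I := vanishingIdeal K ({p} : Set (σ → K))) Ideal.IsPrime.ne_top'
    rw [hdim] at this
    exact_mod_cast this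
  · have : ringKrullDim (MvPolynomial σ K) ≤ (vanishingIdeal K ({p} : Set (σ → K))).height := by
      rw [ringKrullDim_le_iff_isMaximal_height_le]
      intro m hm
      obtain ⟨q, rfl⟩ := eq_vanishingIdeal_singleton_of_isMaximal K hm
      exact_mod_cast key q p
    rw [hdim] at this
    exact_mod_cast this

/-- Among the elements of a vector space `S` there are `n` elements such that the minimal primes
over them have height at least `n`, except for those which contain all of `S`. The elements are
chosen one by one, each outside the previous minimal primes not containing `S`. -/
theorem exists_generators_le_height {K A : Type*} [Field K] [Infinite K] [CommRing A]
    [IsNoetherianRing A] [Algebra K A] (S : Submodule K A) (n : ℕ) :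
    ∃ g : Fin n → A, (∀ i, g i ∈ S) ∧ ∀ q ∈ (Ideal.span (Set.range g)).minimalPrimes,
      (S : Set A) ⊆ q ∨ (n : ℕ∞) ≤ q.height := by
  induction n with
  | zero => exact ⟨Fin.elim0, fun i => i.elim0, fun q _ => Or.inr (by simp)⟩
  | succ n ih =>
    obtain ⟨g, hg, hq⟩ := ih
    have hfin : {q ∈ (Ideal.span (Set.range g)).minimalPrimes | ¬ (S : Set A) ⊆ q}.Finite :=
      (Ideal.finite_minimalPrimes_of_isNoetherianRing A _).subset fun _ h => h.1
    obtain ⟨f, hfS, hf⟩ : ∃ f ∈ S, ∀ q ∈ (Ideal.span (Set.range g)).minimalPrimes,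
        ¬ (S : Set A) ⊆ q → f ∉ q := by
      classical
      let T : Finset (Subspace K S) := hfin.toFinset.image fun q =>
        (q.restrictScalars K).comap S.subtype
      have hT : ⊤ ∉ T := by
        simp only [T, Finset.mem_image, not_exists, not_and]
        intro q hq h
        refine ((Set.Finite.mem_toFinset _).1 hq).2 fun x hx => ?_
        have : (⟨x, hx⟩ : S) ∈ (⊤ : Submodule K S) := trivial
        rw [← h] at this
        exact this
      have := Subspace.biUnion_ne_univ_of_top_notMem hT
      obtain ⟨f, hf⟩ := (Set.ne_univ_iff_exists_notMem _).1 this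
      refine ⟨f, f.2, fun q h1 h2 h3 => hf ?_⟩
      simp only [Set.mem_iUnion]
      exact ⟨_, Finset.mem_image_of_mem _ ((Set.Finite.mem_toFinset _).2 ⟨h1, h2⟩), h3⟩
    refine ⟨Fin.snoc g f, fun i => ?_, fun q hqm => ?_⟩
    · refine Fin.lastCases ?_ (fun i => ?_) i
      · simpa using hfS
      · simpa using hg i
    · have hqp := hqm.1.1
      have hle : Ideal.span (Set.range g) ≤ q := by
        refine le_trans (Ideal.span_mono ?_) hqm.1.2
        rintro _ ⟨i, rfl⟩
        exact ⟨i.castSucc, by simp⟩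
      have hfq : f ∈ q := hqm.1.2 (Ideal.subset_span ⟨Fin.last n, by simp⟩)
      obtain ⟨q', hq', hq'q⟩ := Ideal.exists_minimalPrimes_le hle
      by_cases hS : (S : Set A) ⊆ q'
      · exact Or.inl (hS.trans hq'q)
      · right
        have hlt : q' < q := lt_of_le_of_ne hq'q fun h => hf q' hq' hS (h ▸ hfq)
        have := hq'.1.1
        have h1 := Ideal.height_add_one_le_of_lt_of_isPrime hlt
        have h2 := (hq q' hq').resolve_left hS
        calc ((n + 1 : ℕ) : ℕ∞) = n + 1 := by push_cast; rfl
          _ ≤ q'.height + 1 := by gcongr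
          _ ≤ _ := h1

open MvPolynomial in
theorem eq_vanishingIdeal_singleton_of_zeroLocus_finite {K σ : Type*} [Field K] [IsAlgClosed K]
    [Finite σ] {q : Ideal (MvPolynomial σ K)} (hq : q.IsPrime) (hfin : (zeroLocus K q).Finite)
    {p : σ → K} (hqp : q ≤ vanishingIdeal K {p}) : q = vanishingIdeal K {p} := by
  have h1 : (hfin.toFinset.inf fun x => vanishingIdeal K {x}) ≤ q := by
    refine le_trans ?_ (IsPrime.vanishingIdeal_zeroLocus (K := K) q).le
    intro f hf x hx
    have := (Finset.inf_le (f := fun x => vanishingIdeal K ({x} : Set (σ → K)))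
      (hfin.mem_toFinset.2 hx)) hf
    simpa using this
  obtain ⟨x, -, hx⟩ := (Ideal.IsPrime.inf_le' hq).1 h1
  have hm : (vanishingIdeal K ({x} : Set (σ → K))).IsMaximal := inferInstance
  have := hm.eq_of_le Ideal.IsPrime.ne_top' (hx.trans hqp)
  exact le_antisymm hqp (this ▸ hx)

/-! ### The Bézout inequality in affine space -/

open MvPolynomial in
/-- If the points `p i` are isolated zeros of as many polynomials `g` as there are variables, then
polynomials `e i` with `e i (p j) = δ_ij` are linearly independent over the polynomials in `g`. -/
theorem eq_zero_of_sum_aeval_mul_eq_zero {K σ τ ι : Type*} [Field K] [IsAlgClosed K] [Fintype σ]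
    [Fintype τ] [Nonempty τ] (hcard : Fintype.card τ = Fintype.card σ) [Fintype ι]
    [DecidableEq ι] (g : τ → MvPolynomial σ K) (p : ι → σ → K)
    (hmin : ∀ i, vanishingIdeal K {p i} ∈ (Ideal.span (Set.range g)).minimalPrimes)
    (e : ι → MvPolynomial σ K) (he : ∀ i j, aeval (p j) (e i) = if i = j then (1 : K) else 0)
    (c : ι → MvPolynomial τ K) (h : ∑ i, aeval g (c i) * e i = 0) : c = 0 := by
  classical
  by_contra hc
  obtain ⟨i₀, hi₀⟩ := Function.ne_iff.1 hc
  obtain ⟨j₀⟩ := ‹Nonempty τ›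
  -- A direction `b` of a line through `0` on which not all `c i` vanish.
  obtain ⟨b, hb⟩ : ∃ b : τ → K, eval b (c i₀ * X j₀) ≠ 0 := by
    by_contra! hb
    exact mul_ne_zero hi₀ (X_ne_zero j₀) (MvPolynomial.funext fun x => by simp [hb x])
  simp only [map_mul, eval_X, ne_eq, mul_eq_zero, not_or] at hb
  obtain ⟨hb1, hb2⟩ := hb
  let L : MvPolynomial τ K →ₐ[K] Polynomial K := aeval fun j => Polynomial.C (b j) * Polynomial.X
  have hL : L (c i₀) ≠ 0 := by
    intro h0
    apply hb1
    have : (Polynomial.aeval (1 : K)).comp L = aeval b := by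
      ext1 j
      simp [L]
    have := congrArg (fun φ => φ (c i₀)) this
    simpa [h0, aeval_eq_eval] using this.symm
  obtain ⟨i₁, hi₁, hi₁min⟩ := Finset.exists_min_image (Finset.univ.filter fun i => L (c i) ≠ 0)
    (fun i => (L (c i)).natTrailingDegree) ⟨i₀, by simpa using hL⟩
  set r := (L (c i₁)).natTrailingDegree with hr
  have hdiv : ∀ i, ∃ c', L (c i) = Polynomial.X ^ r * c' := by
    intro i
    by_cases hi : L (c i) = 0
    · exact ⟨0, by simp [hi]⟩
    · refine Polynomial.X_pow_dvd_iff.2 fun d hd => ?_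
      exact Polynomial.coeff_eq_zero_of_lt_natTrailingDegree
        (hd.trans_le (hi₁min i (by simpa using hi)))
  choose c' hc' using hdiv
  have hc'0 : (c' i₁).coeff 0 ≠ 0 := by
    have h1 : L (c i₁) ≠ 0 := by simpa using hi₁
    have h2 := Polynomial.coeff_natTrailingDegree_eq_zero.not.2 h1
    have h3 := Polynomial.coeff_X_pow_mul (c' i₁) r 0
    rw [zero_add] at h3
    rwa [← hr, hc' i₁, h3] at h2
  -- The inverse image under `g` of the line is defined by the vanishing of the `w j`; `t` is the
  -- parameter of the line on it.
  let w : τ → MvPolynomial σ K := fun j => g j - C (b j / b j₀) * g j₀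
  let t : MvPolynomial σ K := C (b j₀)⁻¹ * g j₀
  have hgp : ∀ j, g j ∈ vanishingIdeal K ({p i₁} : Set (σ → K)) := fun j =>
    (hmin i₁).1.2 (Ideal.subset_span ⟨j, rfl⟩)
  have hIle : Ideal.span (w '' {j₀}ᶜ) ≤ vanishingIdeal K {p i₁} := by
    rw [Ideal.span_le]
    rintro _ ⟨j, -, rfl⟩
    exact sub_mem (hgp j) (Ideal.mul_mem_left _ _ (hgp j₀))
  obtain ⟨q, hq, hqle⟩ := Ideal.exists_minimalPrimes_le hIle
  have hqp : q.IsPrime := hq.1.1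
  -- Since `w j₀ = 0`, one generator less than the number of variables is enough.
  have hheight : q.height < Nat.card σ := by
    refine (Ideal.height_le_card_of_mem_minimalPrimes_span (Set.toFinite _) hq).trans_lt ?_
    have h1 : (w '' {j₀}ᶜ).ncard ≤ ({j₀}ᶜ : Set τ).ncard := Set.ncard_image_le (Set.toFinite _)
    have h2 : ({j₀}ᶜ : Set τ).ncard = Fintype.card τ - 1 := by
      rw [Set.ncard_compl, Set.ncard_singleton, Nat.card_eq_fintype_card]
    have h3 : 0 < Fintype.card τ := Fintype.card_pos_iff.2 ⟨j₀⟩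
    have : (w '' {j₀}ᶜ).ncard < Nat.card σ := by
      rw [Nat.card_eq_fintype_card]; omega
    exact_mod_cast this
  have hw : ∀ j, w j ∈ q := by
    intro j
    by_cases hj : j = j₀
    · have : w j = 0 := by simp [w, hj, hb2]
      rw [this]; exact zero_mem _
    · exact hq.1.2 (Ideal.subset_span ⟨j, hj, rfl⟩)
  have ht : t ∉ q := by
    intro ht
    have hg0 : g j₀ ∈ q := by
      have := Ideal.mul_mem_left q (C (b j₀)) ht
      rwa [← mul_assoc, ← C_mul, mul_inv_cancel₀ hb2, C_1, one_mul] at this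
    have hle : Ideal.span (Set.range g) ≤ q := by
      rw [Ideal.span_le]
      rintro _ ⟨j, rfl⟩
      have := add_mem (hw j) (Ideal.mul_mem_left q (C (b j / b j₀)) hg0)
      simpa [w] using this
    have := le_antisymm hqle ((hmin i₁).2 ⟨hqp, hle⟩ hqle)
    rw [this, height_vanishingIdeal_singleton] at hheight
    exact lt_irrefl _ hheight
  have hcongr : ∀ f : MvPolynomial τ K, Ideal.Quotient.mk q (aeval g f) =
      Ideal.Quotient.mk q (Polynomial.aeval t (L f)) := by
    intro f
    have : (Ideal.Quotient.mkₐ K q).comp (aeval g) =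
        ((Ideal.Quotient.mkₐ K q).comp (Polynomial.aeval t)).comp L := by
      ext1 j
      simp only [AlgHom.comp_apply, aeval_X, Ideal.Quotient.mkₐ_eq_mk]
      rw [Ideal.Quotient.eq]
      convert hw j using 1
      simp only [L, t, w, aeval_X, map_mul, Polynomial.aeval_C, Polynomial.aeval_X,
        algebraMap_eq, div_eq_mul_inv]
      ring
    exact congrArg (fun φ => φ f) this
  have hsum : ∑ i, Polynomial.aeval t (c' i) * e i ∈ q := by
    have h1 : t ^ r * ∑ i, Polynomial.aeval t (c' i) * e i ∈ q := by
      rw [← Ideal.Quotient.eq_zero_iff_mem, ← map_zero (Ideal.Quotient.mk q), ← h, Finset.mul_sum,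
        map_sum, map_sum]
      refine Finset.sum_congr rfl fun i _ => ?_
      rw [map_mul _ (aeval g (c i)), hcongr, hc' i, ← map_mul]
      congr 1
      simp only [map_mul, map_pow, Polynomial.aeval_X]
      ring
    exact (hqp.mem_or_mem h1).resolve_left fun h => ht (hqp.mem_of_pow_mem _ h)
  have h2 := (mem_vanishingIdeal_singleton_iff _ _).1 (hqle hsum)
  have h3 : ∀ i, aeval (p i₁) (Polynomial.aeval t (c' i)) = (c' i).coeff 0 := by
    intro i
    have : aeval (p i₁) t = 0 := by
      simp only [t, map_mul, (mem_vanishingIdeal_singleton_iff _ _).1 (hgp j₀), mul_zero]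
    rw [← Polynomial.aeval_algHom_apply, this, Polynomial.coeff_zero_eq_aeval_zero]
  simp only [map_sum, map_mul, h3, he] at h2
  simp [hc'0] at h2

theorem ncard_degree_le_le {σ : Type*} [Fintype σ] (r : ℕ) :
    {a : σ →₀ ℕ | a.degree ≤ r}.Finite ∧
      {a : σ →₀ ℕ | a.degree ≤ r}.ncard ≤ (r + 1) ^ Fintype.card σ := by
  classical
  let f : (σ →₀ ℕ) → (σ → ℕ) := fun a => a
  have hinj : Function.Injective f := DFunLike.coe_injective
  let T : Finset (σ → ℕ) := Fintype.piFinset fun _ => Finset.range (r + 1)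
  have hsub : f '' {a : σ →₀ ℕ | a.degree ≤ r} ⊆ T := by
    rintro _ ⟨a, ha, rfl⟩
    simp only [T, Finset.mem_coe, Fintype.mem_piFinset, Finset.mem_range, f]
    intro i
    have := Finsupp.le_degree i a
    simp only [Set.mem_ofPred_eq] at ha
    omega
  refine ⟨Set.Finite.of_finite_image (T.finite_toSet.subset hsub) hinj.injOn, ?_⟩
  rw [← Set.ncard_image_of_injective _ hinj]
  refine (Set.ncard_le_ncard hsub T.finite_toSet).trans ?_
  rw [Set.ncard_coe_finset]
  simp [T]

/-- There are at most `D ^ m` times as many monomials of degree at most `r D` as there are of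
degree at most `r`: divide the exponents by `D` with remainder. -/
theorem ncard_degree_le_mul_le {σ : Type*} [Fintype σ] {D : ℕ} (hD : 0 < D) (r : ℕ) :
    {a : σ →₀ ℕ | a.degree ≤ r * D}.ncard ≤
      D ^ Fintype.card σ * {a : σ →₀ ℕ | a.degree ≤ r}.ncard := by
  classical
  have : NeZero D := ⟨hD.ne'⟩
  let f : (σ →₀ ℕ) → (σ → Fin D) × (σ →₀ ℕ) := fun a =>
    (fun i => Fin.ofNat D (a i), a.mapRange (· / D) (Nat.zero_div D))
  have hinj : Function.Injective f := by
    intro a b h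
    ext i
    have h1 := congrArg (fun x => (x.1 i : Fin D).val) h
    have h2 := congrArg (fun x => x.2 i) h
    simp only [f, Fin.ofNat, Finsupp.mapRange_apply] at h1 h2
    rw [← Nat.div_add_mod (a i) D, ← Nat.div_add_mod (b i) D, h1, h2]
  rw [← Set.ncard_image_of_injective _ hinj]
  have hsub : f '' {a : σ →₀ ℕ | a.degree ≤ r * D} ⊆
      (Set.univ : Set (σ → Fin D)) ×ˢ {a : σ →₀ ℕ | a.degree ≤ r} := by
    rintro _ ⟨a, ha, rfl⟩
    refine ⟨trivial, ?_⟩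
    simp only [Set.mem_ofPred_eq, Finsupp.degree_eq_sum, f, Finsupp.mapRange_apply] at ha ⊢
    refine Nat.le_of_mul_le_mul_right ((le_trans ?_ ha)) hD
    rw [Finset.sum_mul]
    exact Finset.sum_le_sum fun i _ => Nat.div_mul_le_self _ _
  refine (Set.ncard_le_ncard hsub (Set.finite_univ.prod (ncard_degree_le_le r).1)).trans ?_
  rw [Set.ncard_prod, Set.ncard_univ]
  simp

/-- If `s` grows at most polynomially and `M s(r) ≤ q s(r + E)` for all `r`, then `M ≤ q`;
otherwise `s(j E)` would grow at least like `(M / q) ^ j`. -/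
theorem le_of_growth {s : ℕ → ℕ} {m M q E : ℕ} (h0 : 1 ≤ s 0)
    (hs : ∀ r, s r ≤ (r + 1) ^ m) (h : ∀ r, M * s r ≤ q * s (r + E)) : M ≤ q := by
  by_contra! hlt
  have hq : 0 < q := by
    rcases Nat.eq_zero_or_pos q with rfl | hq
    · have := h 0
      nlinarith
    · exact hq
  have h1 : ∀ j, M ^ j ≤ q ^ j * s (j * E) := by
    intro j
    induction j with
    | zero => simpa using h0
    | succ j ih =>
      calc M ^ (j + 1) = M * M ^ j := by ring
        _ ≤ M * (q ^ j * s (j * E)) := by gcongr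
        _ = q ^ j * (M * s (j * E)) := by ring
        _ ≤ q ^ j * (q * s (j * E + E)) := Nat.mul_le_mul_left _ (h _)
        _ = _ := by rw [add_mul, one_mul]; ring
  have hM : (0 : ℝ) < M := by exact_mod_cast hq.trans hlt
  have hratio : |(q : ℝ) / M| < 1 := by
    rw [abs_of_nonneg (by positivity), div_lt_one hM]
    exact_mod_cast hlt
  have hlim := (tendsto_pow_const_mul_const_pow_of_abs_lt_one m hratio).const_mul
    (((E : ℝ) + 1) ^ m)
  rw [mul_zero] at hlim
  obtain ⟨j, hj1, hj2⟩ := ((hlim.eventually (gt_mem_nhds one_pos)).and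
    (Filter.eventually_ge_atTop 1)).exists
  have h2 : (M : ℝ) ^ j ≤ q ^ j * ((E + 1) * j) ^ m := by
    have : M ^ j ≤ q ^ j * ((E + 1) * j) ^ m := by
      refine (h1 j).trans ?_
      gcongr
      refine (hs _).trans ?_
      gcongr
      nlinarith
    exact_mod_cast this
  rw [div_pow] at hj1
  have hMj : (0 : ℝ) < (M : ℝ) ^ j := by positivity
  have : ((E : ℝ) + 1) ^ m * ((j : ℝ) ^ m * (q ^ j / M ^ j)) =
      q ^ j * ((E + 1) * j) ^ m / M ^ j := by
    rw [mul_pow]; ring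
  rw [this, div_lt_one hMj] at hj1
  linarith

open MvPolynomial in
theorem finrank_restrictTotalDegree {K σ : Type*} [Field K] (r : ℕ) :
    Module.finrank K (restrictTotalDegree σ K r) = {a : σ →₀ ℕ | a.degree ≤ r}.ncard :=
  Module.finrank_eq_nat_card_basis (basisRestrictSupport K {a : σ →₀ ℕ | a.degree ≤ r})

open MvPolynomial in
theorem finite_restrictTotalDegree {K σ : Type*} [Field K] [Fintype σ] (r : ℕ) :
    Module.Finite K (restrictTotalDegree σ K r) :=
  have : Finite {a : σ →₀ ℕ | a.degree ≤ r} := (ncard_degree_le_le r).1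
  Module.Finite.of_basis (basisRestrictSupport K {a : σ →₀ ℕ | a.degree ≤ r})

open MvPolynomial in
theorem totalDegree_aeval_le {K σ τ : Type*} [CommSemiring K] {D : ℕ}
    (g : τ → MvPolynomial σ K) (hg : ∀ j, (g j).totalDegree ≤ D) (f : MvPolynomial τ K) :
    (aeval g f).totalDegree ≤ f.totalDegree * D := by
  rw [aeval_def, eval₂_eq]
  refine totalDegree_finsetSum_le fun a ha => ?_
  refine (totalDegree_mul _ _).trans ?_
  rw [algebraMap_eq, totalDegree_C, zero_add]
  refine (totalDegree_finsetProd _ _).trans ?_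
  calc ∑ i ∈ a.support, (g i ^ a i).totalDegree ≤ ∑ i ∈ a.support, a i * D :=
        Finset.sum_le_sum fun i _ => (totalDegree_pow _ _).trans (Nat.mul_le_mul_left _ (hg i))
    _ = (∑ i ∈ a.support, a i) * D := by rw [Finset.sum_mul]
    _ ≤ _ := Nat.mul_le_mul_right _ (le_totalDegree ha)

open MvPolynomial in
theorem exists_interpolation {K σ : Type*} [Field K] (V : Set (σ → K)) (hV : V.Finite)
    [DecidableEq V] (x : V) :
    ∃ e : MvPolynomial σ K, ∀ y : V, aeval (y : σ → K) e = if x = y then (1 : K) else 0 := by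
  classical
  have := hV.fintype
  have h : ∀ y : V, ∃ l : MvPolynomial σ K, y ≠ x → aeval (x : σ → K) l = (1 : K) ∧
      aeval (y : σ → K) l = (0 : K) := by
    intro y
    by_cases hy : y = x
    · exact ⟨0, fun h => absurd hy h⟩
    · obtain ⟨i, hi⟩ := Function.ne_iff.1 fun h => hy (Subtype.ext h)
      refine ⟨C ((x : σ → K) i - (y : σ → K) i)⁻¹ * (X i - C ((y : σ → K) i)), fun _ => ?_⟩
      simp [inv_mul_cancel₀ (sub_ne_zero.2 (Ne.symm hi))]
  choose l hl using h
  refine ⟨∏ y ∈ Finset.univ.erase x, l y, fun y => ?_⟩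
  rw [map_prod]
  split_ifs with hxy
  · subst hxy
    exact Finset.prod_eq_one fun y hy => (hl y (Finset.ne_of_mem_erase hy)).1
  · exact Finset.prod_eq_zero (Finset.mem_erase.2 ⟨Ne.symm hxy, Finset.mem_univ y⟩)
      (hl y (Ne.symm hxy)).2

open MvPolynomial in
/-- **Affine Bézout inequality**: a finite set of common zeros in affine `m`-space of polynomials
of degree at most `D` has at most `D ^ m` points. -/
theorem ncard_common_zeros_le {K σ : Type*} [Field K] [IsAlgClosed K] [Fintype σ] {D : ℕ}
    (hD : 0 < D) (S : Set (MvPolynomial σ K)) (hS : ∀ f ∈ S, f.totalDegree ≤ D)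
    (hfin : {x : σ → K | ∀ f ∈ S, aeval x f = (0 : K)}.Finite) :
    {x : σ → K | ∀ f ∈ S, aeval x f = (0 : K)}.ncard ≤ D ^ Fintype.card σ := by
  classical
  set V := {x : σ → K | ∀ f ∈ S, aeval x f = (0 : K)} with hV
  rcases isEmpty_or_nonempty σ with hσ | hσ
  · refine (Set.ncard_le_one hfin).2 (fun a _ b _ => Subsingleton.elim a b) |>.trans ?_
    exact Nat.one_le_pow _ _ hD
  obtain ⟨g₀, hg₀S, hg₀⟩ := exists_generators_le_height (Submodule.span K S) (Fintype.card σ)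
  let g : σ → MvPolynomial σ K := g₀ ∘ Fintype.equivFin σ
  have hrange : Set.range g = Set.range g₀ := (Fintype.equivFin σ).surjective.range_comp _
  have hgdeg : ∀ j, (g j).totalDegree ≤ D := by
    intro j
    rw [← mem_restrictTotalDegree]
    refine Submodule.span_le.2 (fun f hf => ?_) (hg₀S _)
    exact (mem_restrictTotalDegree _ _ _).2 (hS f hf)
  have hmin : ∀ x : V, vanishingIdeal K {(x : σ → K)} ∈
      (Ideal.span (Set.range g)).minimalPrimes := by
    intro x
    refine ⟨⟨inferInstance, ?_⟩, ?_⟩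
    · rw [Ideal.span_le]
      rintro _ ⟨j, rfl⟩
      refine Submodule.span_le (p := (vanishingIdeal K {(x : σ → K)}).restrictScalars K).2
        (fun f hf => ?_) (hg₀S _)
      exact (mem_vanishingIdeal_singleton_iff _ _).2 (x.2 f hf)
    · rintro q ⟨hq, hgq⟩ hqx
      obtain ⟨q', hq', hq'q⟩ := Ideal.exists_minimalPrimes_le hgq
      have hq'p : q'.IsPrime := hq'.1.1
      rw [hrange] at hq'
      have heq : q' = vanishingIdeal K {(x : σ → K)} := by
        rcases hg₀ q' hq' with h | h
        · refine eq_vanishingIdeal_singleton_of_zeroLocus_finite hq'p ?_ (hq'q.trans hqx)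
          refine hfin.subset fun y hy f hf => ?_
          exact hy f (h (Submodule.subset_span hf))
        · refine (hq'q.trans hqx).eq_of_not_lt fun hlt => ?_
          have h1 := Ideal.height_add_one_le_of_lt_of_isPrime hlt
          rw [height_vanishingIdeal_singleton, Nat.card_eq_fintype_card] at h1
          have h2 : ((Fintype.card σ : ℕ) : ℕ∞) + 1 ≤ (Fintype.card σ : ℕ) :=
            le_trans (by gcongr) h1
          have h3 : Fintype.card σ + 1 ≤ Fintype.card σ := by exact_mod_cast h2
          omega
      exact heq ▸ hq'q
  have := hfin.fintype
  choose e he using exists_interpolation V hfin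
  let E := Finset.univ.sup fun x => (e x).totalDegree
  have hcount : ∀ r, V.ncard * {a : σ →₀ ℕ | a.degree ≤ r}.ncard ≤
      D ^ Fintype.card σ * {a : σ →₀ ℕ | a.degree ≤ r + E}.ncard := by
    intro r
    refine le_trans ?_ (ncard_degree_le_mul_le hD _)
    let Φ : (V → MvPolynomial σ K) →ₗ[K] MvPolynomial σ K :=
      ∑ x, (LinearMap.mulRight K (e x)).comp
        ((aeval g : MvPolynomial σ K →ₐ[K] MvPolynomial σ K).toLinearMap.comp (LinearMap.proj x))
    have hΦ : ∀ c, Φ c = ∑ x, aeval g (c x) * e x := by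
      intro c
      simp [Φ, LinearMap.sum_apply]
    let ψ : (V → restrictTotalDegree σ K r) →ₗ[K] restrictTotalDegree σ K ((r + E) * D) :=
      (Φ.comp ((restrictTotalDegree σ K r).subtype.compLeft V)).codRestrict _ fun c => by
        rw [mem_restrictTotalDegree, LinearMap.comp_apply, hΦ]
        refine totalDegree_finsetSum_le fun x _ => (totalDegree_mul _ _).trans ?_
        have h1 := totalDegree_aeval_le g hgdeg (c x : MvPolynomial σ K)
        have h2 := (mem_restrictTotalDegree _ _ _).1 (c x).2
        have h3 : (e x).totalDegree ≤ E :=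
          Finset.le_sup (f := fun x => (e x).totalDegree) (Finset.mem_univ x)
        calc _ ≤ r * D + E := add_le_add (h1.trans (Nat.mul_le_mul_right _ h2)) h3
          _ ≤ _ := by nlinarith
    have hψ : Function.Injective ψ := by
      rw [← LinearMap.ker_eq_bot, LinearMap.ker_eq_bot']
      intro c hc
      have h1 : ∑ x, aeval g (c x : MvPolynomial σ K) * e x = 0 := by
        rw [← hΦ fun x => (c x : MvPolynomial σ K)]
        exact congrArg Subtype.val hc
      have := eq_zero_of_sum_aeval_mul_eq_zero rfl g (fun x : V => (x : σ → K)) hmin e he _ h1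
      funext x
      exact Subtype.ext (congrFun this x)
    have := finite_restrictTotalDegree (K := K) (σ := σ) r
    have := finite_restrictTotalDegree (K := K) (σ := σ) ((r + E) * D)
    have h := LinearMap.finrank_le_finrank_of_injective hψ
    rw [Module.finrank_pi_fintype] at h
    simp only [finrank_restrictTotalDegree, Finset.sum_const, Finset.card_univ, smul_eq_mul] at h
    rwa [← Nat.card_eq_fintype_card, Nat.card_coe_set_eq] at h
  refine le_of_growth ?_ (fun r => (ncard_degree_le_le (σ := σ) r).2) hcount
  exact (Set.ncard_pos (ncard_degree_le_le 0).1).2 ⟨0, by simp⟩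

/-! ### Homogeneous polynomials -/

/-- The factors of a nonzero homogeneous polynomial are homogeneous. -/
theorem MvPolynomial.exists_isHomogeneous_of_mul {σ R : Type*} [CommRing R] [IsDomain R]
    {f g : MvPolynomial σ R} {n : ℕ} (h : (f * g).IsHomogeneous n) (h0 : f * g ≠ 0) :
    ∃ a b, f.IsHomogeneous a ∧ g.IsHomogeneous b ∧ a + b = n := by
  -- `φ p = p(T x)` has the homogeneous components of `p` as coefficients; it is a monomial in `T`
  -- exactly when its degree and its trailing degree agree, and both are additive.
  let φ : MvPolynomial σ R →ₐ[R] Polynomial (MvPolynomial σ R) :=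
    aeval fun i => Polynomial.X * Polynomial.C (X i)
  have hmon : ∀ (a : σ →₀ ℕ) (r : R), φ (monomial a r) =
      Polynomial.monomial a.degree (monomial a r) := by
    intro a r
    rw [← Polynomial.C_mul_X_pow_eq_monomial, aeval_monomial, monomial_eq (a := r)]
    simp only [mul_pow, Finsupp.prod, Finset.prod_mul_distrib, map_mul, map_prod, map_pow]
    rw [Finset.prod_pow_eq_pow_sum, ← Finsupp.degree_apply]
    simp only [Polynomial.algebraMap_eq, IsScalarTower.algebraMap_apply R (MvPolynomial σ R)
      (Polynomial (MvPolynomial σ R)), algebraMap_eq]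
    ring
  have hcoeff : ∀ (p : MvPolynomial σ R) (i : ℕ), (φ p).coeff i = homogeneousComponent i p := by
    intro p i
    induction p using MvPolynomial.induction_on' with
    | monomial a r =>
      rw [hmon, Polynomial.coeff_monomial]
      ext d
      rw [coeff_homogeneousComponent]
      classical
      split_ifs with h1 h2 h2
      · rfl
      · rw [coeff_monomial, if_neg]
        rintro rfl; exact h2 h1
      · rw [coeff_monomial, if_neg, coeff_zero]
        rintro rfl; exact h1 h2
      · rfl
    | add p q hp hq => rw [map_add, Polynomial.coeff_add, hp, hq, map_add]
  have heval : ∀ p : MvPolynomial σ R, (φ p).eval 1 = p := by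
    intro p
    have : ((Polynomial.aeval (1 : MvPolynomial σ R)).restrictScalars R).comp φ =
        AlgHom.id R _ := by
      ext1 i
      simp [φ]
    exact congrArg (fun ψ => ψ p) this
  have hhom : ∀ p : MvPolynomial σ R, (φ p).natTrailingDegree = (φ p).natDegree →
      p.IsHomogeneous (φ p).natDegree := by
    intro p hp
    have h1 : φ p = Polynomial.monomial (φ p).natDegree ((φ p).coeff (φ p).natDegree) := by
      ext1 i
      rw [Polynomial.coeff_monomial]
      split_ifs with hi
      · rw [hi]
      · rcases lt_or_gt_of_ne hi with hi | hi
        · exact Polynomial.coeff_eq_zero_of_natDegree_lt hi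
        · exact Polynomial.coeff_eq_zero_of_lt_natTrailingDegree (hp ▸ hi)
    have h2 : p = homogeneousComponent (φ p).natDegree p := by
      conv_lhs => rw [← heval p, h1]
      simp [hcoeff]
    rw [h2]
    simpa [← h2] using homogeneousComponent_isHomogeneous (φ p).natDegree p
  have hprod : φ (f * g) = Polynomial.monomial n (f * g) := by
    ext1 i
    rw [hcoeff, homogeneousComponent_of_mem ((mem_homogeneousSubmodule _ _).2 h),
      Polynomial.coeff_monomial]
    simp only [eq_comm]
  have hf0 : φ f ≠ 0 := fun h => left_ne_zero_of_mul h0 (by rw [← heval f, h, Polynomial.eval_zero])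
  have hg0 : φ g ≠ 0 := fun h =>
    right_ne_zero_of_mul h0 (by rw [← heval g, h, Polynomial.eval_zero])
  have h1 : (φ f).natDegree + (φ g).natDegree = n := by
    rw [← Polynomial.natDegree_mul hf0 hg0, ← map_mul, hprod, Polynomial.natDegree_monomial_eq _ h0]
  have h2 : (φ f).natTrailingDegree + (φ g).natTrailingDegree = n := by
    rw [← Polynomial.natTrailingDegree_mul hf0 hg0, ← map_mul, hprod,
      Polynomial.natTrailingDegree_monomial h0]
  have h3 := Polynomial.natTrailingDegree_le_natDegree (φ f)
  have h4 := Polynomial.natTrailingDegree_le_natDegree (φ g)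
  exact ⟨_, _, hhom f (by omega), hhom g (by omega), h1⟩

theorem MvPolynomial.coeff_aeval_C_mul_X {σ R : Type*} [CommSemiring R] (c : R)
    (p : MvPolynomial σ R) (a : σ →₀ ℕ) :
    coeff a (aeval (fun i => C c * X i) p : MvPolynomial σ R) = c ^ a.degree * coeff a p := by
  classical
  induction p using MvPolynomial.induction_on' with
  | monomial b r =>
    have : (aeval (fun i => C c * X i) (monomial b r) : MvPolynomial σ R) =
        C (c ^ b.degree) * monomial b r := by
      rw [aeval_monomial, monomial_eq (a := r)]
      simp only [mul_pow, Finsupp.prod, Finset.prod_mul_distrib, map_pow, algebraMap_eq,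
        Finsupp.degree_apply]
      rw [Finset.prod_pow_eq_pow_sum]
      ring
    rw [this, coeff_C_mul, coeff_monomial]
    split_ifs with h
    · rw [h]
    · simp
  | add p q hp hq => rw [map_add, coeff_add, hp, hq, coeff_add, mul_add]

theorem MvPolynomial.eval_aeval_C_mul_X {σ R : Type*} [CommSemiring R] (c : R) (x : σ → R)
    (p : MvPolynomial σ R) :
    eval x (aeval (fun i => C c * X i) p : MvPolynomial σ R) = eval (c • x) p := by
  induction p using MvPolynomial.induction_on with
  | C a => simp
  | add p q hp hq => rw [map_add, map_add, hp, hq, map_add]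
  | mul_X p i hp => rw [map_mul, map_mul, hp, map_mul]; simp

theorem MvPolynomial.eval_eval {σ τ R : Type*} [CommSemiring R] (x : σ → R)
    (w : τ → MvPolynomial σ R) (P : MvPolynomial τ (MvPolynomial σ R)) :
    eval x (eval w P) = eval (fun j => eval x (w j)) (map (eval x) P) := by
  induction P using MvPolynomial.induction_on with
  | C a => simp
  | add p q hp hq => simp [hp, hq]
  | mul_X p i hp => simp [hp]

namespace ProjWeb

/-! ### Forms with polynomial coefficients -/

/-- Symmetric forms on `ℂ^(N+1)` with polynomial coefficients: polynomials in `dx_0, …, dx_N` over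
the ring of polynomials in the homogeneous coordinates `x_0, …, x_N`. -/
abbrev Form (N : ℕ) : Type := MvPolynomial (Fin (N + 1)) (Poly N)

/-- The symmetric form `P` at the point `x`, a polynomial in `dx_0, …, dx_N`. -/
noncomputable def Form.at {N : ℕ} (P : Form N) (x : Vec N) : Poly N :=
  MvPolynomial.map (MvPolynomial.eval x) P

theorem Form.coeff_at {N : ℕ} (P : Form N) (x : Vec N) (a : Fin (N + 1) →₀ ℕ) :
    (P.at x).coeff a = MvPolynomial.eval x (P.coeff a) :=
  MvPolynomial.coeff_map _ _ _

/-- The coefficients of `P` have no common factor. -/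
def Form.Primitive {N : ℕ} (P : Form N) : Prop :=
  ∀ h : Poly N, (∀ a, h ∣ P.coeff a) → IsUnit h

theorem Form.Primitive.ne_zero {N : ℕ} {P : Form N} (hP : P.Primitive) : P ≠ 0 := by
  rintro rfl
  exact not_isUnit_zero (hP 0 fun a => by simp)

theorem Form.exists_primitive {N : ℕ} {P : Form N} (hP : P ≠ 0) :
    ∃ (h : Poly N) (Ω : Form N), Ω.Primitive ∧ P = MvPolynomial.C h * Ω := by
  classical
  let _ : NormalizedGCDMonoid (Poly N) := Classical.arbitrary _
  let h := P.support.gcd fun a => P.coeff a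
  obtain ⟨Ω, hΩ⟩ : MvPolynomial.C h ∣ P := by
    rw [MvPolynomial.C_dvd_iff_dvd_coeff]
    intro a
    by_cases ha : a ∈ P.support
    · exact Finset.gcd_dvd ha
    · rw [MvPolynomial.notMem_support_iff.1 ha]; exact dvd_zero _
  have hh : h ≠ 0 := by
    intro h0
    rw [h0] at hΩ
    exact hP (by simp [hΩ])
  refine ⟨h, Ω, fun g hg => ?_, hΩ⟩
  have : h * g ∣ h := by
    refine Finset.dvd_gcd fun a _ => ?_
    rw [hΩ, MvPolynomial.coeff_C_mul]
    exact mul_dvd_mul_left _ (hg a)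
  have h2 : h * g ∣ h * 1 := by rwa [mul_one]
  exact isUnit_of_dvd_one ((mul_dvd_mul_iff_left hh).1 h2)

/-- A rational multiple `(f / g) Ω` of a primitive form which has polynomial coefficients is a
polynomial multiple. -/
theorem Form.Primitive.exists_eq_C_mul {N : ℕ} {Ω P : Form N} (hΩ : Ω.Primitive) {f g : Poly N}
    (hg : g ≠ 0) (h : MvPolynomial.C g * P = MvPolynomial.C f * Ω) :
    ∃ q : Poly N, P = MvPolynomial.C q * Ω := by
  classical
  let _ : NormalizedGCDMonoid (Poly N) := Classical.arbitrary _
  have hunit : IsUnit (Ω.support.gcd fun a => Ω.coeff a) := by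
    refine hΩ _ fun a => ?_
    by_cases ha : a ∈ Ω.support
    · exact Finset.gcd_dvd ha
    · rw [MvPolynomial.notMem_support_iff.1 ha]; exact dvd_zero _
  have hgf : g ∣ f := by
    have h1 : g ∣ Ω.support.gcd fun a => f * Ω.coeff a := by
      refine Finset.dvd_gcd fun a _ => ?_
      rw [← MvPolynomial.coeff_C_mul, ← h, MvPolynomial.coeff_C_mul]
      exact dvd_mul_right _ _
    exact hunit.dvd_mul_right.1 ((Finset.gcd_mul_left' _ _ f).dvd_iff_dvd_right.1 h1)
  obtain ⟨q, rfl⟩ := hgf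
  refine ⟨q, mul_left_cancel₀ (MvPolynomial.C_ne_zero.2 hg) ?_⟩
  rw [h, MvPolynomial.C_mul, mul_assoc]

theorem IsZariskiOpen.exists_basic {N : ℕ} {U : Set (PN N)} (hU : IsZariskiOpen U) {x : Vec N}
    (hx : x ≠ 0) (hxU : pt x hx ∈ U) :
    ∃ (H : Poly N) (e : ℕ), H.IsHomogeneous e ∧ MvPolynomial.eval x H ≠ 0 ∧
      ∀ (y : Vec N) (hy : y ≠ 0), MvPolynomial.eval y H ≠ 0 → pt y hy ∈ U := by
  obtain ⟨S, hS, hSU⟩ := hU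
  obtain ⟨H, hHS, hHx⟩ := (hSU x hx).1 hxU
  obtain ⟨e, he⟩ := hS H hHS
  exact ⟨H, e, he, hHx, fun y hy h => (hSU y hy).2 ⟨H, hHS, h⟩⟩

theorem ne_zero_of_eval_ne_zero {N : ℕ} {x : Vec N} {H : Poly N}
    (h : MvPolynomial.eval x H ≠ 0) : H ≠ 0 := by
  rintro rfl
  exact h (map_zero _)

theorem IsZariskiOpen.exists_ne_zero {N : ℕ} {U : Set (PN N)} (hU : IsZariskiOpen U)
    (hne : U.Nonempty) :
    ∃ H : Poly N, H ≠ 0 ∧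
      ∀ (y : Vec N) (hy : y ≠ 0), MvPolynomial.eval y H ≠ 0 → pt y hy ∈ U := by
  obtain ⟨p, hp⟩ := hne
  induction p using Projectivization.ind with
  | h x hx =>
    obtain ⟨H, e, -, hHx, h⟩ := hU.exists_basic hx hp
    exact ⟨H, ne_zero_of_eval_ne_zero hHx, h⟩

theorem exists_eval_ne_zero {N : ℕ} {H : Poly N} (hH : H ≠ 0) :
    ∃ x : Vec N, x ≠ 0 ∧ MvPolynomial.eval x H ≠ 0 := by
  by_contra! h
  refine mul_ne_zero hH (MvPolynomial.X_ne_zero (R := ℂ) (0 : Fin (N + 1)))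
    (MvPolynomial.funext fun x => ?_)
  by_cases hx : x = 0
  · simp [hx]
  · simp [h x hx]

theorem eq_zero_of_eval_eq_zero {N : ℕ} {H f : Poly N} (hH : H ≠ 0)
    (h : ∀ y : Vec N, y ≠ 0 → MvPolynomial.eval y H ≠ 0 → MvPolynomial.eval y f = 0) : f = 0 := by
  by_contra hf
  obtain ⟨x, hx, hxH⟩ := exists_eval_ne_zero (mul_ne_zero hH hf)
  rw [map_mul] at hxH
  exact right_ne_zero_of_mul hxH (h x hx (left_ne_zero_of_mul hxH))

theorem Form.ext_of_at {N : ℕ} {H : Poly N} (hH : H ≠ 0) {P P' : Form N}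
    (h : ∀ y : Vec N, y ≠ 0 → MvPolynomial.eval y H ≠ 0 → P.at y = P'.at y) : P = P' := by
  ext1 a
  rw [← sub_eq_zero]
  refine eq_zero_of_eval_eq_zero hH fun y hy hyH => ?_
  have := congrArg (MvPolynomial.coeff a) (h y hy hyH)
  rw [Form.coeff_at, Form.coeff_at] at this
  rw [map_sub, this, sub_self]

/-- The section `η` over `U` is given by the fraction `P / Q` wherever `Q ≠ 0`, where `Q` is a
nonzero homogeneous polynomial of degree `e`. -/
def IsPresentation {N : ℕ} (U : Set (PN N)) (η : Vec N → Poly N) (e : ℕ) (Q : Poly N)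
    (P : Form N) : Prop :=
  Q.IsHomogeneous e ∧ Q ≠ 0 ∧ ∀ (y : Vec N) (hy : y ≠ 0), pt y hy ∈ U →
    MvPolynomial.eval y Q ≠ 0 → MvPolynomial.C (MvPolynomial.eval y Q) * η y = P.at y

theorem IsSymForm.exists_presentation {N k : ℕ} {U : Set (PN N)} {η : Vec N → Poly N}
    (hη : IsSymForm k U η) {x : Vec N} (hx : x ≠ 0) (hxU : pt x hx ∈ U) :
    ∃ e Q P, IsPresentation U η e Q P ∧ MvPolynomial.eval x Q ≠ 0 := by
  obtain ⟨e, Q, P, hQ, hQx, h⟩ := hη.regular x hx hxU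
  exact ⟨e, Q, P, ⟨hQ, ne_zero_of_eval_ne_zero hQx, h⟩, hQx⟩

theorem eval_smul_of_isHomogeneous {σ : Type*} {F : MvPolynomial σ ℂ} {e : ℕ}
    (hF : F.IsHomogeneous e) (c : ℂ) (x : σ → ℂ) :
    MvPolynomial.eval (c • x) F = c ^ e * MvPolynomial.eval x F := by
  rw [MvPolynomial.eval_eq, MvPolynomial.eval_eq, Finset.mul_sum]
  refine Finset.sum_congr rfl fun a ha => ?_
  have : ∑ i ∈ a.support, a i = e := by
    have := hF (MvPolynomial.mem_support_iff.1 ha)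
    simpa [Finsupp.weight_apply, Finsupp.sum] using this
  simp only [Pi.smul_apply, smul_eq_mul, mul_pow, Finset.prod_mul_distrib,
    Finset.prod_pow_eq_pow_sum, this]
  ring

theorem IsSymForm.smul_eq {N k : ℕ} {U : Set (PN N)} {η : Vec N → Poly N}
    (hη : IsSymForm k U η) {x : Vec N} (hx : x ≠ 0) (hxU : pt x hx ∈ U) {c : ℂ} (hc : c ≠ 0) :
    MvPolynomial.C (c ^ k) * η (c • x) = η x := by
  have hcx : c • x ≠ 0 := smul_ne_zero hc hx
  have hU : pt (c • x) hcx ∈ U := by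
    have : pt (c • x) hcx = pt x hx :=
      (Projectivization.mk_eq_mk_iff' ℂ _ _ _ _).2 ⟨c, rfl⟩
    rwa [this]
  refine MvPolynomial.funext fun v => ?_
  rw [map_mul, MvPolynomial.eval_C, ← eval_smul_of_isHomogeneous (hη.homogeneous _ hcx hU),
    hη.scale x hx hxU c hc]

/-- The numerator of a `k`-symmetric form with denominator of degree `e` is homogeneous of degree
`k` in `dx_0, …, dx_N`, with coefficients homogeneous of degree `e - k`. -/
theorem IsPresentation.coeff {N k : ℕ} {U : Set (PN N)} {η : Vec N → Poly N}
    (hU : IsZariskiOpen U) (hne : U.Nonempty) (hη : IsSymForm k U η) {e : ℕ} {Q : Poly N}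
    {P : Form N} (h : IsPresentation U η e Q P) {a : Fin (N + 1) →₀ ℕ} (ha : P.coeff a ≠ 0) :
    a.degree = k ∧ ∃ f, (P.coeff a).IsHomogeneous f ∧ f + k = e := by
  obtain ⟨H, hH, hHU⟩ := hU.exists_ne_zero hne
  obtain ⟨hQ, hQ0, hQP⟩ := h
  constructor
  · obtain ⟨y, hy, hyH⟩ := exists_eval_ne_zero (mul_ne_zero (mul_ne_zero hH hQ0) ha)
    simp only [map_mul, ne_eq, mul_eq_zero, not_or] at hyH
    have hyU := hHU y hy hyH.1.1
    have h1 := congrArg (MvPolynomial.coeff a) (hQP y hy hyU hyH.1.2)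
    rw [Form.coeff_at, MvPolynomial.coeff_C_mul] at h1
    have h2 : (η y).coeff a ≠ 0 := by
      intro h0
      rw [h0, mul_zero] at h1
      exact hyH.2 h1.symm
    by_contra hk
    exact h2 ((hη.homogeneous y hy hyU).coeff_eq_zero hk)
  -- A polynomial which is multiplied by a fixed power of `2` under `x ↦ 2 x` is homogeneous.
  · have key : MvPolynomial.C ((2 : ℂ) ^ k) *
        (MvPolynomial.aeval (fun i => MvPolynomial.C 2 * MvPolynomial.X i) (P.coeff a) : Poly N) =
        MvPolynomial.C ((2 : ℂ) ^ e) * P.coeff a := by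
      rw [← sub_eq_zero]
      refine eq_zero_of_eval_eq_zero (mul_ne_zero hH hQ0) fun y hy hyH => ?_
      simp only [map_mul, ne_eq, mul_eq_zero, not_or] at hyH
      have hyU := hHU y hy hyH.1
      have h2y : (2 : ℂ) • y ≠ 0 := smul_ne_zero two_ne_zero hy
      have hU2 : pt ((2 : ℂ) • y) h2y ∈ U := by
        have : pt ((2 : ℂ) • y) h2y = pt y hy :=
          (Projectivization.mk_eq_mk_iff' ℂ _ _ _ _).2 ⟨2, rfl⟩
        rwa [this]
      have hQ2 : MvPolynomial.eval ((2 : ℂ) • y) Q = 2 ^ e * MvPolynomial.eval y Q :=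
        eval_smul_of_isHomogeneous hQ 2 y
      have h1 := hQP y hy hyU hyH.2
      have h2 := hQP _ h2y hU2 (by rw [hQ2]; exact mul_ne_zero (pow_ne_zero _ two_ne_zero) hyH.2)
      have h3 : MvPolynomial.C ((2 : ℂ) ^ k) * P.at ((2 : ℂ) • y) =
          MvPolynomial.C ((2 : ℂ) ^ e) * P.at y := by
        rw [← h1, ← h2, ← hη.smul_eq hy hyU two_ne_zero, hQ2, MvPolynomial.C_mul]
        ring
      have h4 := congrArg (MvPolynomial.coeff a) h3
      simp only [Form.coeff_at, MvPolynomial.coeff_C_mul] at h4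
      have h5 : MvPolynomial.eval y (MvPolynomial.aeval
          (fun i => MvPolynomial.C 2 * MvPolynomial.X i) (P.coeff a) : Poly N) =
          MvPolynomial.eval ((2 : ℂ) • y) (P.coeff a) :=
        MvPolynomial.eval_aeval_C_mul_X 2 y _
      simp only [map_sub, map_mul, MvPolynomial.eval_C, h5, h4, sub_self]
    have hdeg : ∀ b, (P.coeff a).coeff b ≠ 0 → b.degree + k = e := by
      intro b hb
      have h1 := congrArg (MvPolynomial.coeff b) key
      rw [MvPolynomial.coeff_C_mul, MvPolynomial.coeff_C_mul, MvPolynomial.coeff_aeval_C_mul_X,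
        ← mul_assoc, ← pow_add] at h1
      have h2 := mul_right_cancel₀ hb h1
      have h3 : (2 : ℕ) ^ (k + b.degree) = 2 ^ e := by exact_mod_cast h2
      have := Nat.pow_right_injective le_rfl h3
      omega
    obtain ⟨b, hb⟩ := MvPolynomial.ne_zero_iff.1 ha
    refine ⟨b.degree, fun {d} hd => ?_, hdeg b hb⟩
    have h1 := hdeg b hb
    have h2 := hdeg d hd
    have : d.degree = b.degree := by omega
    rw [← this]
    simp [Finsupp.weight_apply, Finsupp.degree_eq_sum, Finsupp.sum_fintype]

/-! ### The global form defining a web -/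

/-- `Ω` is a global twisted `k`-symmetric form defining the web `W`, with coefficients of degree
`δ` without common factor. As a section of `Sym^k Ω¹ ⊗ 𝒪(δ + k)` it is given by a form on
`ℂ^(N+1)` which annihilates the radial direction, and locally it is a unit times `ω i`, where the
unit is the fraction `G / F` of homogeneous polynomials, of degree `δ + k` like a local generator
of `𝒪(δ + k)`. -/
structure IsGlobalForm {N k : ℕ} (W : CodimOneWeb N k) (Ω : Form N) (δ : ℕ) : Prop where
  primitive : Ω.Primitive
  coeff_isHomogeneous : ∀ a, (Ω.coeff a).IsHomogeneous δ
  isHomogeneous : Ω.IsHomogeneous k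
  radial : ∀ (x v : Vec N) (c : ℂ),
    MvPolynomial.eval (v + c • x) (Ω.at x) = MvPolynomial.eval v (Ω.at x)
  exists_local : ∀ (i : W.ι) (x : Vec N) (hx : x ≠ 0), pt x hx ∈ W.U i →
    ∃ (f e : ℕ) (F G : Poly N), F.IsHomogeneous f ∧ G.IsHomogeneous e ∧ f + δ + k = e ∧
      MvPolynomial.eval x F ≠ 0 ∧ MvPolynomial.eval x G ≠ 0 ∧
      ∀ (y : Vec N) (hy : y ≠ 0), pt y hy ∈ W.U i → MvPolynomial.eval y G ≠ 0 →
        MvPolynomial.C (MvPolynomial.eval y G) * W.ω i y =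
          MvPolynomial.C (MvPolynomial.eval y F) * Ω.at y

theorem Form.zero_at {N : ℕ} (y : Vec N) : (0 : Form N).at y = 0 := map_zero _

theorem Form.eval_eval {N : ℕ} (y : Vec N) (w : Fin (N + 1) → Poly N) (P : Form N) :
    MvPolynomial.eval y (MvPolynomial.eval w P) =
      MvPolynomial.eval (fun j => MvPolynomial.eval y (w j)) (P.at y) :=
  MvPolynomial.eval_eval y w P

theorem Form.C_mul_at {N : ℕ} (h : Poly N) (P : Form N) (y : Vec N) :
    (MvPolynomial.C h * P : Form N).at y =
      MvPolynomial.C (MvPolynomial.eval y h) * P.at y := by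
  simp [Form.at]

theorem Form.C_mul_right_injective {N : ℕ} {Ω : Form N} (hΩ : Ω ≠ 0) {f g : Poly N}
    (h : (MvPolynomial.C f * Ω : Form N) = MvPolynomial.C g * Ω) : f = g :=
  MvPolynomial.C_injective _ _ (mul_right_cancel₀ hΩ h)

theorem exists_prime_factor_eval_eq_zero {N : ℕ} {h : Poly N} (h0 : h ≠ 0) {x : Vec N}
    (hx : MvPolynomial.eval x h = 0) :
    ∃ p : Poly N, Prime p ∧ p ∣ h ∧ MvPolynomial.eval x p = 0 := by
  obtain ⟨s, hs, hsh⟩ := UniqueFactorizationMonoid.exists_prime_factors h h0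
  have h1 : MvPolynomial.eval x s.prod = 0 := by
    obtain ⟨u, hu⟩ := hsh.symm
    rw [← hu, map_mul, hx, zero_mul]
  rw [map_multiset_prod, Multiset.prod_eq_zero_iff, Multiset.mem_map] at h1
  obtain ⟨p, hp, hpx⟩ := h1
  exact ⟨p, hs p hp, (Multiset.dvd_prod hp).trans hsh.dvd, hpx⟩

/-- Some form of the web is, up to a rational factor, a primitive form. -/
theorem CodimOneWeb.exists_presentation_eq {N k : ℕ} (W : CodimOneWeb N k) :
    ∃ (i : W.ι) (e : ℕ) (Q : Poly N) (h : Poly N) (Ω : Form N),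
      IsPresentation (W.U i) (W.ω i) e Q (MvPolynomial.C h * Ω) ∧ h ≠ 0 ∧ Ω.Primitive := by
  obtain ⟨i, -⟩ := W.covers (pt (fun _ => 1) (fun h => one_ne_zero (congrFun h 0)))
  obtain ⟨O, -, ⟨p, hp⟩, hOU, hO⟩ := W.squarefree i
  induction p using Projectivization.ind with
  | h x hx =>
    obtain ⟨e, Q, P, hP, hQx⟩ := (W.isForm i).exists_presentation hx (hOU hp)
    have hP0 : P ≠ 0 := by
      rintro rfl
      have h1 := hP.2.2 x hx (hOU hp) hQx
      rw [Form.zero_at, mul_eq_zero, MvPolynomial.C_eq_zero] at h1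
      exact (hO x hx hp).ne_zero (h1.resolve_left hQx)
    obtain ⟨h, Ω, hΩ, rfl⟩ := Form.exists_primitive hP0
    refine ⟨i, e, Q, h, Ω, hP, ?_, hΩ⟩
    rintro rfl
    exact hP0 (by simp)

/-- The numerators of all forms of the web are multiples of the same primitive form, since any two
of these forms are proportional on a dense open set. -/
theorem CodimOneWeb.exists_eq_C_mul {N k : ℕ} (W : CodimOneWeb N k) {i₀ : W.ι} {e₀ : ℕ}
    {Q₀ h₀ : Poly N} {Ω : Form N}
    (hp₀ : IsPresentation (W.U i₀) (W.ω i₀) e₀ Q₀ (MvPolynomial.C h₀ * Ω)) (hh₀ : h₀ ≠ 0)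
    (hΩ : Ω.Primitive) {i : W.ι} {e : ℕ} {Q : Poly N} {P : Form N}
    (hp : IsPresentation (W.U i) (W.ω i) e Q P) :
    ∃ h : Poly N, h ≠ 0 ∧ P = MvPolynomial.C h * Ω := by
  obtain ⟨H₀, hH₀, hH₀U⟩ := (W.isOpen i₀).exists_ne_zero (W.nonempty i₀)
  obtain ⟨H, hH, hHU⟩ := (W.isOpen i).exists_ne_zero (W.nonempty i)
  obtain ⟨x, hx, hxH⟩ := exists_eval_ne_zero (mul_ne_zero hH₀ hH)
  simp only [map_mul, ne_eq, mul_eq_zero, not_or] at hxH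
  obtain ⟨-, F, G, -, -, hFx, hGx, hFG⟩ :=
    W.compatible i i₀ x hx ⟨hHU x hx hxH.2, hH₀U x hx hxH.1⟩
  have hF := ne_zero_of_eval_ne_zero hFx
  have hG := ne_zero_of_eval_ne_zero hGx
  have key : (MvPolynomial.C (G * Q₀) * P : Form N) = MvPolynomial.C (Q * F * h₀) * Ω := by
    refine Form.ext_of_at (mul_ne_zero (mul_ne_zero (mul_ne_zero hH₀ hH) (mul_ne_zero hF hG))
      (mul_ne_zero hp₀.2.1 hp.2.1)) fun y hy hyH => ?_
    simp only [map_mul, ne_eq, mul_eq_zero, not_or] at hyH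
    obtain ⟨⟨⟨h1, h2⟩, h3, h4⟩, h5, h6⟩ := hyH
    have e1 := hFG y hy ⟨hHU y hy h2, hH₀U y hy h1⟩ h3 h4
    have e2 := hp₀.2.2 y hy (hH₀U y hy h1) h5
    have e3 := hp.2.2 y hy (hHU y hy h2) h6
    rw [Form.C_mul_at] at e2 ⊢
    rw [Form.C_mul_at]
    simp only [map_mul]
    rw [← e3]
    linear_combination MvPolynomial.C (MvPolynomial.eval y Q) *
      MvPolynomial.C (MvPolynomial.eval y Q₀) * e1 + MvPolynomial.C (MvPolynomial.eval y Q) *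
      MvPolynomial.C (MvPolynomial.eval y F) * e2
  obtain ⟨h, rfl⟩ := hΩ.exists_eq_C_mul (mul_ne_zero hG hp₀.2.1) key
  refine ⟨h, ?_, rfl⟩
  rintro rfl
  rw [map_zero, zero_mul, mul_zero, eq_comm, mul_eq_zero, MvPolynomial.C_eq_zero] at key
  exact mul_ne_zero (mul_ne_zero hp.2.1 hF) hh₀ (key.resolve_right hΩ.ne_zero)

/-- Every web is defined by a global twisted form. -/
theorem CodimOneWeb.exists_globalForm {N k : ℕ} (W : CodimOneWeb N k) :
    ∃ Ω δ, IsGlobalForm W Ω δ := by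
  obtain ⟨i₀, e₀, Q₀, h₀, Ω, hp₀, hh₀, hΩ⟩ := W.exists_presentation_eq
  obtain ⟨a₀, ha₀⟩ := MvPolynomial.ne_zero_iff.1 hΩ.ne_zero
  have hcoeff : ∀ a, Ω.coeff a ≠ 0 → ∀ {i e Q h}, h ≠ 0 →
      IsPresentation (W.U i) (W.ω i) e Q (MvPolynomial.C h * Ω) →
      a.degree = k ∧ ∃ f δ, h.IsHomogeneous f ∧ (Ω.coeff a).IsHomogeneous δ ∧ f + δ + k = e := by
    intro a ha i e Q h hh hp
    have h1 : (MvPolynomial.C h * Ω : Form N).coeff a ≠ 0 := by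
      rw [MvPolynomial.coeff_C_mul]; exact mul_ne_zero hh ha
    obtain ⟨h2, f, h3, h4⟩ := hp.coeff (W.isOpen i) (W.nonempty i) (W.isForm i) h1
    rw [MvPolynomial.coeff_C_mul] at h1 h3
    obtain ⟨f', δ, h5, h6, h7⟩ := MvPolynomial.exists_isHomogeneous_of_mul h3 h1
    exact ⟨h2, f', δ, h5, h6, by omega⟩
  obtain ⟨-, f₀, δ, hf₀, hδ, hsum₀⟩ := hcoeff a₀ ha₀ hh₀ hp₀
  have hdeg : ∀ {i e Q h}, h ≠ 0 → IsPresentation (W.U i) (W.ω i) e Q (MvPolynomial.C h * Ω) →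
      ∃ f, h.IsHomogeneous f ∧ f + δ + k = e := by
    intro i e Q h hh hp
    obtain ⟨-, f, δ', hf, hδ', hsum⟩ := hcoeff a₀ ha₀ hh hp
    obtain rfl := hδ'.inj_right hδ ha₀
    exact ⟨f, hf, hsum⟩
  obtain ⟨H₀, hH₀, hH₀U⟩ := (W.isOpen i₀).exists_ne_zero (W.nonempty i₀)
  refine ⟨Ω, δ, hΩ, fun a => ?_, fun {a} ha => ?_, fun x v c => ?_, fun i x hx hxU => ?_⟩
  · by_cases ha : Ω.coeff a = 0
    · rw [ha]; exact MvPolynomial.isHomogeneous_zero _ _ _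
    · obtain ⟨-, f, δ', hf, hδ', hsum⟩ := hcoeff a ha hh₀ hp₀
      obtain rfl := hf.inj_right hf₀ hh₀
      obtain rfl : δ' = δ := by omega
      exact hδ'
  · rw [← (hcoeff a ha hh₀ hp₀).1]
    simp [Finsupp.weight_apply, Finsupp.degree_eq_sum, Finsupp.sum_fintype]
  · let w₁ : Fin (N + 1) → Poly N := fun j =>
      MvPolynomial.C (v j) + MvPolynomial.C c * MvPolynomial.X j
    let w₂ : Fin (N + 1) → Poly N := fun j => MvPolynomial.C (v j)
    have hw₁ : ∀ y, MvPolynomial.eval y (MvPolynomial.eval w₁ Ω) =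
        MvPolynomial.eval (v + c • y) (Ω.at y) := by
      intro y
      rw [Form.eval_eval]
      congr 2
      funext j
      simp [w₁]
    have hw₂ : ∀ y, MvPolynomial.eval y (MvPolynomial.eval w₂ Ω) =
        MvPolynomial.eval v (Ω.at y) := by
      intro y
      rw [Form.eval_eval]
      congr 2
      funext j
      simp [w₂]
    have : MvPolynomial.eval w₁ Ω - MvPolynomial.eval w₂ Ω = 0 := by
      refine eq_zero_of_eval_eq_zero (mul_ne_zero (mul_ne_zero hH₀ hp₀.2.1) hh₀)
        fun y hy hyH => ?_
      simp only [map_mul, ne_eq, mul_eq_zero, not_or] at hyH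
      obtain ⟨⟨h1, h2⟩, h3⟩ := hyH
      have e1 := hp₀.2.2 y hy (hH₀U y hy h1) h2
      rw [Form.C_mul_at] at e1
      have e2 := congrArg (MvPolynomial.eval (v + c • y)) e1
      have e3 := congrArg (MvPolynomial.eval v) e1
      rw [map_mul, map_mul, MvPolynomial.eval_C, MvPolynomial.eval_C] at e2 e3
      rw [(W.isForm i₀).radial y hy (hH₀U y hy h1), e3] at e2
      rw [map_sub, hw₁, hw₂, mul_left_cancel₀ h3 e2, sub_self]
    rw [← hw₁, ← hw₂, sub_eq_zero.1 this]
  · obtain ⟨e, Q, P, hp, hQx⟩ := (W.isForm i).exists_presentation hx hxU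
    obtain ⟨h, hh, rfl⟩ := W.exists_eq_C_mul hp₀ hh₀ hΩ hp
    obtain ⟨f, hf, hsum⟩ := hdeg hh hp
    refine ⟨f, e, h, Q, hf, hp.1, hsum, fun hhx => ?_, hQx, fun y hy hyU hyQ => ?_⟩
    -- If `h` vanished at `x`, an irreducible factor `p` of it would. As `ω i ≠ 0` somewhere on the
    -- hypersurface `p = 0`, comparison with a presentation near such a point `z` shows that `p`
    -- divides `Q`, or a numerator that does not vanish at `z`.
    · obtain ⟨p, hpp, ⟨r, hr⟩, hpx⟩ := exists_prime_factor_eval_eq_zero hh hhx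
      obtain ⟨s, -, hps, -, -⟩ := MvPolynomial.exists_isHomogeneous_of_mul (hr ▸ hf) (hr ▸ hh)
      obtain ⟨z, hz, hzU, hpz, hωz⟩ := W.codim i p s hps hpp.irreducible ⟨x, hx, hxU, hpx⟩
      obtain ⟨e', Q', P', hp', hQz⟩ := (W.isForm i).exists_presentation hz hzU
      obtain ⟨h', hh', rfl⟩ := W.exists_eq_C_mul hp₀ hh₀ hΩ hp'
      have hh'z : MvPolynomial.eval z h' ≠ 0 := by
        intro h0
        have := hp'.2.2 z hz hzU hQz
        rw [Form.C_mul_at, h0, map_zero, zero_mul, mul_eq_zero, MvPolynomial.C_eq_zero] at this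
        exact hωz (this.resolve_left hQz)
      obtain ⟨H, hH, hHU⟩ := (W.isOpen i).exists_ne_zero (W.nonempty i)
      have key : Q' * h = Q * h' := by
        refine Form.C_mul_right_injective hΩ.ne_zero ?_
        refine Form.ext_of_at (mul_ne_zero hH (mul_ne_zero hp.2.1 hp'.2.1)) fun y hy hyH => ?_
        simp only [map_mul, ne_eq, mul_eq_zero, not_or] at hyH
        have e1 := hp.2.2 y hy (hHU y hy hyH.1) hyH.2.1
        have e2 := hp'.2.2 y hy (hHU y hy hyH.1) hyH.2.2
        rw [Form.C_mul_at] at e1 e2 ⊢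
        rw [Form.C_mul_at]
        simp only [map_mul]
        linear_combination MvPolynomial.C (MvPolynomial.eval y Q) * e2 -
          MvPolynomial.C (MvPolynomial.eval y Q') * e1
      have hdvd : p ∣ Q * h' := key ▸ (Dvd.intro r hr.symm).mul_left Q'
      rcases hpp.dvd_or_dvd hdvd with ⟨q, hq⟩ | ⟨q, hq⟩
      · exact hQx (by rw [hq, map_mul, hpx, zero_mul])
      · exact hh'z (by rw [hq, map_mul, hpz, zero_mul])
    · rw [hp.2.2 y hy hyU hyQ, Form.C_mul_at]

/-! ### The degree of the global form -/

/-- The value `P(x, v)` of the form `P` at the point `x` on the tangent vector `v`, where `x` and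
`v` may have coordinates in any `ℂ`-algebra, such as a ring of polynomials in parameters. -/
noncomputable def Form.value {N : ℕ} {T : Type*} [CommRing T] [Algebra ℂ T] (P : Form N)
    (x v : Fin (N + 1) → T) : T :=
  MvPolynomial.eval₂ (MvPolynomial.aeval x : Poly N →ₐ[ℂ] T).toRingHom v P

theorem Form.map_value {N : ℕ} {T T' : Type*} [CommRing T] [Algebra ℂ T] [CommRing T']
    [Algebra ℂ T'] (ψ : T →ₐ[ℂ] T') (P : Form N) (x v : Fin (N + 1) → T) :
    ψ (P.value x v) = P.value (fun i => ψ (x i)) (fun i => ψ (v i)) := by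
  have h : ∀ p : Poly N, ψ (MvPolynomial.aeval x p) = MvPolynomial.aeval (fun i => ψ (x i)) p := by
    intro p
    rw [← AlgHom.comp_apply, MvPolynomial.comp_aeval]
  unfold Form.value
  induction P using MvPolynomial.induction_on with
  | C a => simpa using h a
  | add p q hp hq => simp only [MvPolynomial.eval₂_add, map_add, hp, hq]
  | mul_X p i hp => simp only [MvPolynomial.eval₂_mul, map_mul, hp, MvPolynomial.eval₂_X]

theorem Form.value_eq {N : ℕ} (P : Form N) (x v : Vec N) :
    P.value x v = MvPolynomial.eval v (P.at x) := by
  unfold Form.value Form.at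
  rw [MvPolynomial.eval_map]
  congr 1

theorem Form.exists_value_ne_zero {N : ℕ} {P : Form N} (hP : P ≠ 0) :
    ∃ x v : Vec N, P.value x v ≠ 0 := by
  by_contra! h
  refine hP (Form.ext_of_at one_ne_zero fun x _ _ => ?_)
  rw [Form.zero_at]
  exact MvPolynomial.funext fun v => by rw [← Form.value_eq, h, map_zero]

section
variable {N k : ℕ} {W : CodimOneWeb N k} {Ω : Form N} {δ : ℕ} (h : IsGlobalForm W Ω δ)
include h

theorem IsGlobalForm.value_add_smul (x v : Vec N) (c : ℂ) :
    Ω.value x (v + c • x) = Ω.value x v := by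
  rw [Form.value_eq, Form.value_eq, h.radial]

theorem IsGlobalForm.value_smul_right (x v : Vec N) (c : ℂ) :
    Ω.value x (c • v) = c ^ k * Ω.value x v := by
  rw [Form.value_eq, Form.value_eq]
  exact eval_smul_of_isHomogeneous (h.isHomogeneous.map _) c v

theorem IsGlobalForm.value_smul_left (x v : Vec N) (c : ℂ) :
    Ω.value (c • x) v = c ^ δ * Ω.value x v := by
  have : Ω.at (c • x) = MvPolynomial.C (c ^ δ) * Ω.at x := by
    ext1 a
    rw [MvPolynomial.coeff_C_mul, Form.coeff_at, Form.coeff_at,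
      eval_smul_of_isHomogeneous (h.coeff_isHomogeneous a)]
  rw [Form.value_eq, Form.value_eq, this, map_mul, MvPolynomial.eval_C]

theorem IsGlobalForm.value_smul_self (hk : 1 ≤ k) (x : Vec N) (c : ℂ) :
    Ω.value x (c • x) = 0 := by
  have h1 := h.value_add_smul x 0 c
  have h2 := h.value_smul_right x 0 0
  rw [zero_pow (by omega), zero_mul, zero_smul] at h2
  rw [← h2, ← h1, zero_add]

theorem IsGlobalForm.linearIndependent (hk : 1 ≤ k) {a b : Vec N} (hab : Ω.value a b ≠ 0)
    (hba : Ω.value b a ≠ 0) : LinearIndependent ℂ ![a, b] := by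
  rw [LinearIndependent.pair_iff]
  intro s t hst
  constructor
  · by_contra hs
    apply hba
    have : a = (-(s⁻¹ * t)) • b := by
      have := congrArg (s⁻¹ • ·) hst
      simp only [smul_add, smul_smul, inv_mul_cancel₀ hs, one_smul, smul_zero] at this
      rw [neg_smul, eq_neg_iff_add_eq_zero, this]
    conv_lhs => rw [this]
    exact h.value_smul_self hk _ _
  · by_contra ht
    apply hab
    have : b = (-(t⁻¹ * s)) • a := by
      have := congrArg (t⁻¹ • ·) hst
      simp only [smul_add, smul_smul, inv_mul_cancel₀ ht, one_smul, smul_zero] at this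
      rw [neg_smul, eq_neg_iff_add_eq_zero, add_comm, this]
    conv_lhs => rw [this]
    exact h.value_smul_self hk _ _

end

/-- The coordinates of the point `q + t r` of a line, as polynomials in `t`. -/
noncomputable def lineCoord {N : ℕ} (q r : Vec N) (i : Fin (N + 1)) : Polynomial ℂ :=
  Polynomial.C (q i) + Polynomial.X * Polynomial.C (r i)

theorem aeval_lineCoord {N : ℕ} (q r : Vec N) (t : ℂ) :
    (fun i => Polynomial.aeval t (lineCoord q r i)) = q + t • r := by
  funext i
  simp [lineCoord, mul_comm t]

/-- The restriction of `P` to the line `t ↦ q + t r`: the polynomial `P(q + t r, r)` in `t`. -/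
noncomputable def Form.onLine {N : ℕ} (P : Form N) (q r : Vec N) : Polynomial ℂ :=
  P.value (lineCoord q r) fun i => Polynomial.C (r i)

theorem Form.eval_onLine {N : ℕ} (P : Form N) (q r : Vec N) (t : ℂ) :
    (P.onLine q r).eval t = P.value (q + t • r) r := by
  rw [← Polynomial.coe_aeval_eq_eval]
  change Polynomial.aeval t (P.value _ _) = _
  rw [Form.map_value, aeval_lineCoord]
  congr 1
  funext i
  simp

theorem analyticAt_eval_line {N : ℕ} (F : Poly N) (q r : Vec N) :
    AnalyticAt ℂ (fun t : ℂ => MvPolynomial.eval (q + t • r) F) 0 := by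
  have : (fun t : ℂ => MvPolynomial.eval (q + t • r) F) =
      fun t => (MvPolynomial.aeval (lineCoord q r) F : Polynomial ℂ).eval t := by
    funext t
    rw [← aeval_lineCoord q r t, ← Polynomial.coe_aeval_eq_eval]
    change _ = (Polynomial.aeval t) (MvPolynomial.aeval (lineCoord q r) F)
    rw [← AlgHom.comp_apply, MvPolynomial.comp_aeval, MvPolynomial.aeval_eq_eval]
  rw [this]
  exact (Polynomial.differentiable _).analyticAt 0

/-- On a line, `ω i` and `Ω` differ by a unit and vanish to the same order. -/
theorem IsGlobalForm.analyticOrderAt_eq {N k : ℕ} {W : CodimOneWeb N k} {Ω : Form N} {δ : ℕ}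
    (h : IsGlobalForm W Ω δ) {i : W.ι} {q : Vec N} (hq : q ≠ 0) (hqU : pt q hq ∈ W.U i)
    (r : Vec N) :
    analyticOrderAt (fun t : ℂ => MvPolynomial.eval r (W.ω i (q + t • r))) 0 =
      analyticOrderAt (fun t : ℂ => (Ω.onLine q r).eval t) 0 := by
  obtain ⟨f, e, F, G, -, -, -, hF, hG, hFG⟩ := h.exists_local i q hq hqU
  obtain ⟨H, -, -, hHq, hHU⟩ := (W.isOpen i).exists_basic hq hqU
  have hFa := analyticAt_eval_line F q r
  have hGa := analyticAt_eval_line G q r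
  have hG0 : MvPolynomial.eval (q + (0 : ℂ) • r) G ≠ 0 := by simpa using hG
  have hu : AnalyticAt ℂ (fun t : ℂ => MvPolynomial.eval (q + t • r) F /
      MvPolynomial.eval (q + t • r) G) 0 := hFa.div hGa hG0
  have hP : AnalyticAt ℂ (fun t : ℂ => (Ω.onLine q r).eval t) 0 :=
    (Polynomial.differentiable _).analyticAt 0
  have hev : (fun t : ℂ => MvPolynomial.eval r (W.ω i (q + t • r))) =ᶠ[𝓝 0]
      (fun t : ℂ => MvPolynomial.eval (q + t • r) F / MvPolynomial.eval (q + t • r) G) *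
        fun t : ℂ => (Ω.onLine q r).eval t := by
    have h1 : ∀ᶠ t : ℂ in 𝓝 0, MvPolynomial.eval (q + t • r) G ≠ 0 :=
      hGa.continuousAt.eventually_ne hG0
    have h2 : ∀ᶠ t : ℂ in 𝓝 0, MvPolynomial.eval (q + t • r) H ≠ 0 :=
      (analyticAt_eval_line H q r).continuousAt.eventually_ne (by simpa using hHq)
    have h3 : ∀ᶠ t : ℂ in 𝓝 0, q + t • r ≠ 0 := by
      have : ContinuousAt (fun t : ℂ => q + t • r) 0 := by fun_prop
      exact this.eventually_ne (by simpa using hq)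
    filter_upwards [h1, h2, h3] with t ht1 ht2 ht3
    have := congrArg (MvPolynomial.eval r) (hFG _ ht3 (hHU _ ht3 ht2) ht1)
    rw [map_mul, map_mul, MvPolynomial.eval_C, MvPolynomial.eval_C] at this
    rw [Pi.mul_apply, Form.eval_onLine, Form.value_eq]
    rw [div_mul_eq_mul_div, eq_div_iff ht1, mul_comm, this]
  rw [analyticOrderAt_congr hev, analyticOrderAt_mul hu hP, hu.analyticOrderAt_eq_zero.2, zero_add]
  simpa using ⟨hF, hG⟩

theorem analyticOrderAt_eval_polynomial {p : Polynomial ℂ} (hp : p ≠ 0) (s : ℂ) :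
    analyticOrderAt (fun t : ℂ => p.eval (s + t)) 0 = p.rootMultiplicity s := by
  obtain ⟨g, hg, hgs⟩ := Polynomial.exists_eq_pow_rootMultiplicity_mul_and_not_dvd p hp s
  have hd : Differentiable ℂ fun t : ℂ => p.eval (s + t) :=
    p.differentiable.comp (by fun_prop)
  have hdg : Differentiable ℂ fun t : ℂ => g.eval (s + t) :=
    g.differentiable.comp (by fun_prop)
  rw [(hd.analyticAt 0).analyticOrderAt_eq_natCast]
  refine ⟨_, hdg.analyticAt 0, ?_, Filter.Eventually.of_forall fun t => ?_⟩
  · rw [Polynomial.dvd_iff_isRoot] at hgs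
    simpa using hgs
  · conv_lhs => rw [hg]
    simp

/-- The restriction of `Ω` to a line has degree `δ - k` in the affine coordinate when the point at
infinity `b` of the line is not a tangency point. -/
theorem IsGlobalForm.natDegree_onLine {N k : ℕ} {W : CodimOneWeb N k} {Ω : Form N} {δ : ℕ}
    (h : IsGlobalForm W Ω δ) {a b : Vec N} (hab : Ω.value a b ≠ 0) (hba : Ω.value b a ≠ 0) :
    (Ω.onLine a b).natDegree + k = δ := by
  set r := Ω.onLine a b with hr
  set r' := Ω.onLine b a with hr'
  have hr0 : r ≠ 0 := by
    intro h0
    have := Ω.eval_onLine a b 0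
    rw [← hr, h0, zero_smul, add_zero, Polynomial.eval_zero] at this
    exact hab this.symm
  have hr'0 : r'.coeff 0 ≠ 0 := by
    rw [Polynomial.coeff_zero_eq_eval_zero, Form.eval_onLine, zero_smul, add_zero]
    exact hba
  -- Changing the affine coordinate from `t` to `1 / t` gives `t ^ k r'(t) = ± t ^ δ r(1 / t)`.
  have key : Polynomial.X ^ (r.natDegree + k) * r' =
      Polynomial.C ((-1) ^ k) * (Polynomial.X ^ δ * r.reverse) := by
    refine Polynomial.eq_of_infinite_eval_eq _ _
      (Set.Infinite.mono ?_ (Set.finite_singleton (0 : ℂ)).infinite_compl)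
    intro t ht
    have ht : t ≠ 0 := ht
    have h1 : b + t • a = t • (a + t⁻¹ • b) := by
      rw [smul_add, smul_smul, mul_inv_cancel₀ ht, one_smul, add_comm]
    have h2 : a = (-t⁻¹) • b + (1 : ℂ) • (a + t⁻¹ • b) := by
      rw [one_smul, neg_smul]; abel
    have h3 : Ω.value (b + t • a) a = t ^ δ * ((-t⁻¹) ^ k * r.eval t⁻¹) := by
      rw [h1, h.value_smul_left]
      conv_lhs => rw [show Ω.value (a + t⁻¹ • b) a =
        Ω.value (a + t⁻¹ • b) ((-t⁻¹) • b + (1 : ℂ) • (a + t⁻¹ • b)) by rw [← h2]]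
      rw [h.value_add_smul, h.value_smul_right, Form.eval_onLine]
    have h4 : r.reverse.eval t = t ^ r.natDegree * r.eval t⁻¹ := by
      let _ : Invertible t⁻¹ := invertibleOfNonzero (inv_ne_zero ht)
      have := Polynomial.eval₂_reverse_mul_pow (RingHom.id ℂ) t⁻¹ r
      rw [invOf_eq_inv, inv_inv, Polynomial.eval₂_id, Polynomial.eval₂_id] at this
      rw [← this, mul_left_comm, ← mul_pow, mul_inv_cancel₀ ht, one_pow, mul_one]
    change Polynomial.eval t _ = Polynomial.eval t _
    simp only [Polynomial.eval_mul, Polynomial.eval_pow, Polynomial.eval_X, Polynomial.eval_C,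
      h4, hr', Form.eval_onLine, h3]
    rw [neg_pow, inv_pow, pow_add]
    field_simp
  have hrev : r.reverse ≠ 0 := Polynomial.reverse_eq_zero.not.2 hr0
  have h1 := congrArg Polynomial.natTrailingDegree key
  rw [Polynomial.natTrailingDegree_mul (pow_ne_zero _ Polynomial.X_ne_zero)
      (by rintro h; exact hr'0 (by rw [h, Polynomial.coeff_zero])),
    Polynomial.natTrailingDegree_mul (Polynomial.C_ne_zero.2 (by simp))
      (mul_ne_zero (pow_ne_zero _ Polynomial.X_ne_zero) hrev),
    Polynomial.natTrailingDegree_mul (pow_ne_zero _ Polynomial.X_ne_zero) hrev,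
    Polynomial.natTrailingDegree_X_pow, Polynomial.natTrailingDegree_X_pow,
    Polynomial.natTrailingDegree_C,
    Polynomial.natTrailingDegree_eq_zero.2 (Or.inr hr'0)] at h1
  have h2 : r.reverse.natTrailingDegree = 0 := Polynomial.natTrailingDegree_reverse r
  omega

/-- The coefficients of the global form of a `k`-web of degree `d` have degree `d + k`. -/
theorem IsGlobalForm.degree_eq {N k d : ℕ} (hk : 1 ≤ k) {W : CodimOneWeb N k} {Ω : Form N} {δ : ℕ}
    (h : IsGlobalForm W Ω δ) (hd : W.HasDegree d) : δ = d + k := by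
  classical
  obtain ⟨R, hR, hRD⟩ := hd
  let x₁ : Fin (N + 1) → MvPolynomial (Fin (N + 1) ⊕ Fin (N + 1)) ℂ := fun i =>
    MvPolynomial.X (Sum.inl i)
  let x₂ : Fin (N + 1) → MvPolynomial (Fin (N + 1) ⊕ Fin (N + 1)) ℂ := fun i =>
    MvPolynomial.X (Sum.inr i)
  have hx₁ : ∀ a b : Vec N,
      (fun i => MvPolynomial.aeval (Sum.elim a b : _ → ℂ) (x₁ i)) = a := by
    intro a b; funext i; simp [x₁]
  have hx₂ : ∀ a b : Vec N,
      (fun i => MvPolynomial.aeval (Sum.elim a b : _ → ℂ) (x₂ i)) = b := by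
    intro a b; funext i; simp [x₂]
  have hA : ∀ a b : Vec N, MvPolynomial.aeval (Sum.elim a b) (Ω.value x₁ x₂) = Ω.value a b := by
    intro a b
    rw [Form.map_value, hx₁, hx₂]
  have hB : ∀ a b : Vec N, MvPolynomial.aeval (Sum.elim a b) (Ω.value x₂ x₁) = Ω.value b a := by
    intro a b
    rw [Form.map_value, hx₁, hx₂]
  obtain ⟨x, v, hxv⟩ := Form.exists_value_ne_zero h.primitive.ne_zero
  have hA0 : Ω.value x₁ x₂ ≠ 0 := fun h0 => hxv (by rw [← hA, h0, map_zero])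
  have hB0 : Ω.value x₂ x₁ ≠ 0 := fun h0 => hxv (by rw [← hB, h0, map_zero])
  obtain ⟨z, hz⟩ : ∃ z, MvPolynomial.eval z (R * (Ω.value x₁ x₂ * Ω.value x₂ x₁)) ≠ 0 := by
    by_contra! h0
    exact mul_ne_zero hR (mul_ne_zero hA0 hB0) (MvPolynomial.funext fun z => by rw [h0, map_zero])
  obtain ⟨a, b, rfl⟩ : ∃ a b : Vec N, z = Sum.elim a b :=
    ⟨z ∘ Sum.inl, z ∘ Sum.inr, (Sum.elim_comp_inl_inr z).symm⟩
  rw [map_mul, map_mul, ← MvPolynomial.aeval_eq_eval, hA, hB] at hz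
  have hRz := left_ne_zero_of_mul hz
  have hab := left_ne_zero_of_mul (right_ne_zero_of_mul hz)
  have hba := right_ne_zero_of_mul (right_ne_zero_of_mul hz)
  have hli := h.linearIndependent hk hab hba
  obtain ⟨D, hD, hDd⟩ := hRD a b hli hRz
  have hline : ∀ z : Fin 2 → ℂ, z ≠ 0 → lineMap a b z ≠ 0 := by
    intro z hz h0
    apply hz
    have := LinearIndependent.pair_iff.1 hli (z 0) (z 1) h0
    funext i
    fin_cases i
    · exact this.1
    · exact this.2
  have hr0 : Ω.onLine a b ≠ 0 := by
    intro h0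
    have := Ω.eval_onLine a b 0
    rw [h0, zero_smul, add_zero, Polynomial.eval_zero] at this
    exact hab this.symm
  have hne : ∀ s : ℂ, (![1, s] : Fin 2 → ℂ) ≠ 0 := fun s h0 => one_ne_zero (congrFun h0 0)
  let ψ : ℂ → ℙ ℂ (Fin 2 → ℂ) := fun s => Projectivization.mk ℂ ![1, s] (hne s)
  have hψ : Function.Injective ψ := by
    intro s t hst
    obtain ⟨c, hc⟩ := (Projectivization.mk_eq_mk_iff' ℂ _ _ _ _).1 hst
    have h0 := congrFun hc 0
    have h1 := congrFun hc 1
    simp at h0 h1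
    rw [← h1, h0, one_mul]
  -- The tangency divisor is the divisor of zeros of `Ω.onLine a b` in the affine part `ψ` of the
  -- line, and is zero at infinity because `Ω(b, a) ≠ 0`.
  have hDψ : ∀ s, D (ψ s) = (Ω.onLine a b).rootMultiplicity s := by
    intro s
    have hq := hline _ (hne s)
    obtain ⟨i, hi⟩ := W.covers (pt _ hq)
    have h1 := hD ![1, s] ![0, 1] (hne s) (by
      rw [LinearIndependent.pair_iff]
      intro x y hxy
      have h0 := congrFun hxy 0
      have h1 := congrFun hxy 1
      simp at h0 h1
      subst h0
      simpa using h1) i hq hi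
    have h2 : lineMap a b ![0, 1] = b := by simp [lineMap]
    have h3 : lineMap a b ![1, s] = a + s • b := by simp [lineMap]
    rw [h2, h.analyticOrderAt_eq hq hi] at h1
    have h4 : (fun t : ℂ => (Ω.onLine (lineMap a b ![1, s]) b).eval t) =
        fun t => (Ω.onLine a b).eval (s + t) := by
      funext t
      rw [Form.eval_onLine, Form.eval_onLine, h3, add_smul, add_assoc]
    rw [h4, analyticOrderAt_eval_polynomial hr0] at h1
    exact_mod_cast h1.symm
  have hinf : (![0, 1] : Fin 2 → ℂ) ≠ 0 := fun h0 => one_ne_zero (congrFun h0 1)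
  have hDinf : D (Projectivization.mk ℂ ![0, 1] hinf) = 0 := by
    have hq := hline _ hinf
    obtain ⟨i, hi⟩ := W.covers (pt _ hq)
    have h1 := hD ![0, 1] ![1, 0] hinf (by
      rw [LinearIndependent.pair_iff]
      intro x y hxy
      have h0 := congrFun hxy 0
      have h1 := congrFun hxy 1
      simp at h0 h1
      exact ⟨h1, h0⟩) i hq hi
    have h2 : lineMap a b ![1, 0] = a := by simp [lineMap]
    have h3 : lineMap a b ![0, 1] = b := by simp [lineMap]
    rw [h2, h.analyticOrderAt_eq hq hi, AnalyticAt.analyticOrderAt_eq_zero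
      ((Polynomial.differentiable _).analyticAt 0) |>.2] at h1
    · exact_mod_cast h1.symm
    · rw [Form.eval_onLine, h3, zero_smul, add_zero]
      exact hba
  have hsupp : D.support ⊆ (Ω.onLine a b).roots.toFinset.image ψ := by
    intro p hp
    rw [Finsupp.mem_support_iff] at hp
    induction p using Projectivization.ind with
    | h z hz =>
      by_cases hz0 : z 0 = 0
      · exfalso
        apply hp
        have : Projectivization.mk ℂ z hz = Projectivization.mk ℂ ![0, 1] hinf := by
          refine (Projectivization.mk_eq_mk_iff' ℂ _ _ _ _).2 ⟨z 1, ?_⟩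
          funext i
          fin_cases i <;> simp [hz0]
        rw [this, hDinf]
      · have : Projectivization.mk ℂ z hz = ψ (z 1 / z 0) := by
          refine (Projectivization.mk_eq_mk_iff' ℂ _ _ _ _).2 ⟨z 0, ?_⟩
          funext i
          fin_cases i <;> simp [mul_div_cancel₀ _ hz0]
        rw [this] at hp ⊢
        rw [hDψ] at hp
        refine Finset.mem_image_of_mem _ (Multiset.mem_toFinset.2 ?_)
        rw [Polynomial.mem_roots hr0]
        exact (Polynomial.rootMultiplicity_pos hr0).1 (Nat.pos_of_ne_zero hp)
  have hsum : D.sum (fun _ m => m) = (Ω.onLine a b).natDegree := by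
    rw [Finsupp.sum_of_support_subset D hsupp _ (fun _ _ => rfl), Finset.sum_image hψ.injOn]
    simp only [hDψ, ← Polynomial.count_roots]
    rw [Multiset.toFinset_sum_count_eq]
    exact (IsAlgClosed.splits _).natDegree_eq_card_roots.symm
  have := h.natDegree_onLine hab hba
  omega

/-! ### Automorphisms of the web and of the global form -/

/-- The pull-back of the form `P` by the linear map `A`. -/
noncomputable def Form.pullback {N : ℕ} (A : GL (Fin (N + 1)) ℂ) (P : Form N) : Form N :=
  P.value (fun i => ∑ j, MvPolynomial.C (MvPolynomial.C (A i j) * MvPolynomial.X j))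
    (fun i => ∑ j, MvPolynomial.C (MvPolynomial.C (A i j)) * MvPolynomial.X j)

theorem Form.value_pullback {N : ℕ} (A : GL (Fin (N + 1)) ℂ) (P : Form N) (x v : Vec N) :
    (P.pullback A).value x v = P.value (A • x) (A • v) := by
  let ψ : Form N →ₐ[ℂ] ℂ := (MvPolynomial.aeval v : Poly N →ₐ[ℂ] ℂ).comp
    (MvPolynomial.mapAlgHom (MvPolynomial.aeval x : Poly N →ₐ[ℂ] ℂ))
  have hψ : ∀ Q : Form N, Q.value x v = ψ Q := by
    intro Q
    rw [Form.value_eq]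
    rfl
  rw [hψ, Form.pullback, Form.map_value]
  congr 1
  · funext i
    simp only [ψ, map_sum, AlgHom.comp_apply, MvPolynomial.mapAlgHom_apply, MvPolynomial.map_C,
      RingHom.coe_coe, map_mul, MvPolynomial.aeval_C, MvPolynomial.aeval_X]
    rfl
  · funext i
    simp only [ψ, map_sum, AlgHom.comp_apply, MvPolynomial.mapAlgHom_apply, MvPolynomial.map_C,
      MvPolynomial.map_X, RingHom.coe_coe, map_mul, MvPolynomial.aeval_C, MvPolynomial.aeval_X]
    rfl

theorem Form.value_C_mul {N : ℕ} (f : Poly N) (P : Form N) (x v : Vec N) :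
    (MvPolynomial.C f * P : Form N).value x v = MvPolynomial.eval x f * P.value x v := by
  rw [Form.value_eq, Form.value_eq, Form.C_mul_at, map_mul, MvPolynomial.eval_C]

section
variable {N k : ℕ} {W : CodimOneWeb N k} {Ω : Form N} {δ : ℕ}

theorem IsGlobalForm.exists_local_value (h : IsGlobalForm W Ω δ) {i : W.ι} {x : Vec N}
    (hx : x ≠ 0) (hxU : pt x hx ∈ W.U i) :
    ∃ (f e : ℕ) (F G : Poly N), F.IsHomogeneous f ∧ G.IsHomogeneous e ∧ f + δ + k = e ∧
      MvPolynomial.eval x F ≠ 0 ∧ MvPolynomial.eval x G ≠ 0 ∧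
      ∀ (y : Vec N) (hy : y ≠ 0), pt y hy ∈ W.U i → MvPolynomial.eval y G ≠ 0 → ∀ v,
        MvPolynomial.eval y G * MvPolynomial.eval v (W.ω i y) =
          MvPolynomial.eval y F * Ω.value y v := by
  obtain ⟨f, e, F, G, hF, hG, hs, hFx, hGx, hFG⟩ := h.exists_local i x hx hxU
  refine ⟨f, e, F, G, hF, hG, hs, hFx, hGx, fun y hy hyU hyG v => ?_⟩
  have := congrArg (MvPolynomial.eval v) (hFG y hy hyU hyG)
  rwa [map_mul, map_mul, MvPolynomial.eval_C, MvPolynomial.eval_C, ← Form.value_eq] at this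

theorem eval_subst_ne_zero {N : ℕ} {A : GL (Fin (N + 1)) ℂ} {F : Poly N} {x : Vec N}
    (h : MvPolynomial.eval (A • x) F ≠ 0) : subst A F ≠ 0 :=
  ne_zero_of_eval_ne_zero (x := x) (by rwa [eval_subst])

/-- An automorphism of the web multiplies `Ω` by a constant: the pull-back is a rational multiple
of the primitive form `Ω`, hence a polynomial multiple, and the degrees agree. -/
theorem IsGlobalForm.exists_scalar_of_preserves (h : IsGlobalForm W Ω δ)
    {A : GL (Fin (N + 1)) ℂ} (hA : W.Preserves A) :
    ∃ c : ℂ, c ≠ 0 ∧ ∀ x v : Vec N, Ω.value (A • x) (A • v) = c * Ω.value x v := by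
  obtain ⟨x, hx, -⟩ := exists_eval_ne_zero (N := N) (H := 1) one_ne_zero
  have hAx : A • x ≠ 0 := (smul_ne_zero_iff_ne A).2 hx
  obtain ⟨i, hi⟩ := W.covers (pt x hx)
  obtain ⟨j, hj⟩ := W.covers (pt (A • x) hAx)
  obtain ⟨f₁, e₁, F₁, G₁, hF₁, hG₁, hs₁, hF₁x, hG₁x, hFG₁⟩ := h.exists_local_value hx hi
  obtain ⟨f₂, e₂, F₂, G₂, hF₂, hG₂, hs₂, hF₂x, hG₂x, hFG₂⟩ := h.exists_local_value hAx hj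
  obtain ⟨H₁, -, -, hH₁x, hH₁⟩ := (W.isOpen i).exists_basic hx hi
  obtain ⟨H₂, -, -, hH₂x, hH₂⟩ := (W.isOpen j).exists_basic hAx hj
  obtain ⟨e, F, G, hF, hG, hFx, hGx, hFG⟩ := hA i j x hx ⟨hi, hj⟩
  have hF0 := ne_zero_of_eval_ne_zero hFx
  have hG0 := ne_zero_of_eval_ne_zero hGx
  have hF₁0 := ne_zero_of_eval_ne_zero hF₁x
  have hG₁0 := ne_zero_of_eval_ne_zero hG₁x
  have hF₂0 := eval_subst_ne_zero hF₂x
  have hG₂0 := eval_subst_ne_zero hG₂x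
  have hH₁0 := ne_zero_of_eval_ne_zero hH₁x
  have hH₂0 := eval_subst_ne_zero hH₂x
  have key : (MvPolynomial.C (G * G₁ * subst A F₂) * Ω.pullback A : Form N) =
      MvPolynomial.C (F * F₁ * subst A G₂) * Ω := by
    refine Form.ext_of_at (mul_ne_zero (mul_ne_zero (mul_ne_zero hF0 hG0)
      (mul_ne_zero hG₁0 hG₂0)) (mul_ne_zero hH₁0 hH₂0)) fun y hy hyH => ?_
    simp only [map_mul, ne_eq, mul_eq_zero, not_or, eval_subst] at hyH
    obtain ⟨⟨⟨h1, h2⟩, h3, h4⟩, h5, h6⟩ := hyH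
    have hAy : A • y ≠ 0 := (smul_ne_zero_iff_ne A).2 hy
    have hyi := hH₁ y hy h5
    have hyj := hH₂ _ hAy h6
    refine MvPolynomial.funext fun v => ?_
    have e1 := congrArg (MvPolynomial.eval v) (hFG y hy ⟨hyi, hyj⟩ h1 h2)
    rw [map_mul, map_mul, MvPolynomial.eval_C, MvPolynomial.eval_C, eval_pullback] at e1
    have e2 := hFG₁ y hy hyi h3 v
    have e3 := hFG₂ _ hAy hyj h4 (A • v)
    rw [← Form.value_eq, ← Form.value_eq, Form.value_C_mul, Form.value_C_mul,
      Form.value_pullback]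
    simp only [map_mul, eval_subst]
    linear_combination (-MvPolynomial.eval y G * MvPolynomial.eval y G₁) * e3 +
      MvPolynomial.eval y G₁ * MvPolynomial.eval (A • y) G₂ * e1 +
      MvPolynomial.eval y F * MvPolynomial.eval (A • y) G₂ * e2
  obtain ⟨q, hq⟩ := h.primitive.exists_eq_C_mul
    (mul_ne_zero (mul_ne_zero hG0 hG₁0) hF₂0) key
  rw [hq, ← mul_assoc, ← MvPolynomial.C_mul] at key
  have key2 := Form.C_mul_right_injective h.primitive.ne_zero key
  have hR0 : F * F₁ * subst A G₂ ≠ 0 := mul_ne_zero (mul_ne_zero hF0 hF₁0) hG₂0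
  have hRh := (hF.mul hF₁).mul (subst_isHomogeneous A hG₂)
  obtain ⟨a, b, ha, hb, hab⟩ := MvPolynomial.exists_isHomogeneous_of_mul (key2 ▸ hRh) (key2 ▸ hR0)
  have ha' := ha.inj_right ((hG.mul hG₁).mul (subst_isHomogeneous A hF₂))
    (mul_ne_zero (mul_ne_zero hG0 hG₁0) hF₂0)
  obtain rfl : b = 0 := by omega
  rw [← MvPolynomial.totalDegree_zero_iff_isHomogeneous,
    MvPolynomial.totalDegree_eq_zero_iff_eq_C] at hb
  have hq0 : q ≠ 0 := by
    rintro rfl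
    rw [mul_zero] at key2
    exact hR0 key2.symm
  refine ⟨q.coeff 0, fun h0 => hq0 (by rw [hb, h0, map_zero]), fun x v => ?_⟩
  rw [← Form.value_pullback, hq, hb, Form.value_C_mul, MvPolynomial.eval_C]
  simp

theorem IsGlobalForm.preserves (h : IsGlobalForm W Ω δ) {A : GL (Fin (N + 1)) ℂ} {c : ℂ}
    (hc : c ≠ 0) (hA : ∀ x v : Vec N, Ω.value (A • x) (A • v) = c * Ω.value x v) :
    W.Preserves A := by
  intro i j x hx hxU
  have hAx : A • x ≠ 0 := (smul_ne_zero_iff_ne A).2 hx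
  obtain ⟨f₁, e₁, F₁, G₁, hF₁, hG₁, hs₁, hF₁x, hG₁x, hFG₁⟩ := h.exists_local_value hx hxU.1
  obtain ⟨f₂, e₂, F₂, G₂, hF₂, hG₂, hs₂, hF₂x, hG₂x, hFG₂⟩ :=
    h.exists_local_value (i := j) hAx hxU.2
  refine ⟨f₂ + e₁, MvPolynomial.C c * (subst A F₂ * G₁), subst A G₂ * F₁,
    ((subst_isHomogeneous A hF₂).mul hG₁).C_mul c, ?_, ?_, ?_, fun y hy hyU hyF hyG => ?_⟩
  · have := (subst_isHomogeneous A hG₂).mul hF₁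
    rwa [show e₂ + f₁ = f₂ + e₁ by omega] at this
  · simp only [map_mul, MvPolynomial.eval_C, eval_subst]
    exact mul_ne_zero hc (mul_ne_zero hF₂x hG₁x)
  · simp only [map_mul, eval_subst]
    exact mul_ne_zero hG₂x hF₁x
  · simp only [map_mul, ne_eq, mul_eq_zero, not_or, eval_subst] at hyF hyG
    have hAy : A • y ≠ 0 := (smul_ne_zero_iff_ne A).2 hy
    refine MvPolynomial.funext fun v => ?_
    have e2 := hFG₁ y hy hyU.1 hyF.2.2 v
    have e3 := hFG₂ _ hAy hyU.2 hyG.1 (A • v)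
    simp only [map_mul, MvPolynomial.eval_C, eval_subst, eval_pullback]
    rw [hA] at e3
    linear_combination MvPolynomial.eval y F₁ * e3 -
      c * MvPolynomial.eval (A • y) F₂ * e2

end

/-! ### Counting the matrices which fix the global form -/

/-- The set of the matrices `M`, invertible or not, with `Ω(Mx, Mv) = Ω(x, v)`. -/
def Form.stabilizer {N : ℕ} (Ω : Form N) : Set (Matrix (Fin (N + 1)) (Fin (N + 1)) ℂ) :=
  {M | ∀ x v : Vec N, Ω.value (M.mulVec x) (M.mulVec v) = Ω.value x v}

theorem Form.totalDegree_value_le {N k δ : ℕ} {σ : Type*} {Ω : Form N}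
    (hδ : ∀ a, (Ω.coeff a).IsHomogeneous δ) (hk : Ω.IsHomogeneous k)
    {x v : Fin (N + 1) → MvPolynomial σ ℂ} (hx : ∀ i, (x i).totalDegree ≤ 1)
    (hv : ∀ i, (v i).totalDegree ≤ 1) : (Ω.value x v).totalDegree ≤ δ + k := by
  rw [Form.value, MvPolynomial.eval₂_eq]
  refine MvPolynomial.totalDegree_finsetSum_le fun a ha => ?_
  refine (MvPolynomial.totalDegree_mul _ _).trans (add_le_add ?_ ?_)
  · refine (totalDegree_aeval_le x hx _).trans ?_
    rw [mul_one]
    exact (hδ a).totalDegree_le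
  · refine (MvPolynomial.totalDegree_finsetProd _ _).trans ?_
    rw [hk.degree_eq_sum_deg_support ha]
    refine Finset.sum_le_sum fun i _ => (MvPolynomial.totalDegree_pow _ _).trans ?_
    exact (Nat.mul_le_mul_left _ (hv i)).trans_eq (mul_one _)

theorem Form.ncard_stabilizer_le {N k δ : ℕ} {Ω : Form N} (hδ : ∀ a, (Ω.coeff a).IsHomogeneous δ)
    (hk : Ω.IsHomogeneous k) (hpos : 0 < δ + k) (hfin : Ω.stabilizer.Finite) :
    Ω.stabilizer.ncard ≤ (δ + k) ^ (N + 1) ^ 2 := by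
  let σ := Fin (N + 1) × Fin (N + 1)
  let Y : Vec N → Fin (N + 1) → MvPolynomial σ ℂ := fun x i =>
    ∑ j, MvPolynomial.X (i, j) * MvPolynomial.C (x j)
  have hY : ∀ x i, (Y x i).totalDegree ≤ 1 := by
    intro x i
    refine MvPolynomial.totalDegree_finsetSum_le fun j _ => ?_
    refine (MvPolynomial.totalDegree_mul _ _).trans ?_
    rw [MvPolynomial.totalDegree_X, MvPolynomial.totalDegree_C]
  let f : Vec N × Vec N → MvPolynomial σ ℂ := fun p =>
    Ω.value (Y p.1) (Y p.2) - MvPolynomial.C (Ω.value p.1 p.2)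
  let u : Matrix (Fin (N + 1)) (Fin (N + 1)) ℂ → σ → ℂ := fun M p => M p.1 p.2
  have hu : Function.Injective u := fun M M' h => by
    ext i j
    exact congrFun h (i, j)
  have hYu : ∀ M x, (fun i => MvPolynomial.aeval (u M) (Y x i)) = M.mulVec x := by
    intro M x
    funext i
    simp [Y, u, Matrix.mulVec, dotProduct]
  have hV : {z : σ → ℂ | ∀ g ∈ Set.range f, MvPolynomial.aeval z g = (0 : ℂ)} =
      u '' Ω.stabilizer := by
    ext z
    have hz : ∃ M, u M = z := ⟨fun i j => z (i, j), rfl⟩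
    obtain ⟨M, rfl⟩ := hz
    rw [hu.mem_set_image]
    simp only [Set.mem_ofPred_eq, Set.forall_mem_range, Prod.forall, f, map_sub, Form.map_value,
      hYu, MvPolynomial.aeval_C, sub_eq_zero]
    rfl
  have := ncard_common_zeros_le hpos (Set.range f) (by
    rintro _ ⟨p, rfl⟩
    refine (MvPolynomial.totalDegree_sub _ _).trans (max_le ?_ ?_)
    · exact Form.totalDegree_value_le hδ hk (hY _) (hY _)
    · rw [MvPolynomial.totalDegree_C]; exact Nat.zero_le _) (by rw [hV]; exact hfin.image u)
  rw [hV, Set.ncard_image_of_injective _ hu] at this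
  rwa [Fintype.card_prod, Fintype.card_fin, ← sq] at this

section
variable {N k : ℕ} {W : CodimOneWeb N k} {Ω : Form N} {δ : ℕ}

theorem IsGlobalForm.preserves_of_mem_stabilizer (h : IsGlobalForm W Ω δ)
    {A : GL (Fin (N + 1)) ℂ} (hA : A.val ∈ Ω.stabilizer) : W.Preserves A :=
  h.preserves one_ne_zero fun x v => by rw [one_mul]; exact hA x v

/-- If the automorphism group is finite, the matrices which fix `Ω` are invertible: a singular one
with `M u = 0` would give the automorphisms `x ↦ x + n l(x) u`, where `l(u) = 0` and `n : ℕ`. -/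
theorem IsGlobalForm.det_ne_zero (hN : 1 ≤ N) (h : IsGlobalForm W Ω δ) [Finite W.autGroup]
    {M : Matrix (Fin (N + 1)) (Fin (N + 1)) ℂ} (hM : M ∈ Ω.stabilizer) : M.det ≠ 0 := by
  intro hdet
  obtain ⟨u, hu, hMu⟩ := Matrix.exists_mulVec_eq_zero_iff.2 hdet
  have htrans : ∀ (x v : Vec N) (s t : ℂ), Ω.value (x + s • u) (v + t • u) = Ω.value x v := by
    intro x v s t
    rw [← hM, ← hM x v]
    simp only [Matrix.mulVec_add, Matrix.mulVec_smul, hMu, smul_zero, add_zero]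
  obtain ⟨i, hi⟩ := Function.ne_iff.1 hu
  have : Nontrivial (Fin (N + 1)) := Fin.nontrivial_iff_two_le.2 (by omega)
  obtain ⟨j, hj⟩ := exists_ne i
  let l : Vec N := Pi.single j (u i) - Pi.single i (u j)
  have hlu : l ⬝ᵥ u = 0 := by
    simp only [l, sub_dotProduct, single_dotProduct]
    ring
  have hlj : l j = u i := by simp [l, hj]
  let T : ℕ → Matrix (Fin (N + 1)) (Fin (N + 1)) ℂ := fun n =>
    1 + (n : ℂ) • Matrix.vecMulVec u l
  have hT : ∀ n x, (T n).mulVec x = x + ((n : ℂ) * (l ⬝ᵥ x)) • u := by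
    intro n x
    simp only [T, Matrix.add_mulVec, Matrix.one_mulVec, Matrix.smul_mulVec,
      Matrix.vecMulVec_mulVec]
    simp [smul_smul]
  have hTdet : ∀ n, (T n).det ≠ 0 := by
    intro n h0
    obtain ⟨x, hx, hTx⟩ := Matrix.exists_mulVec_eq_zero_iff.2 h0
    rw [hT] at hTx
    have h1 := congrArg (l ⬝ᵥ ·) hTx
    simp only [dotProduct_add, dotProduct_smul, hlu, smul_zero, add_zero, dotProduct_zero] at h1
    rw [h1, mul_zero, zero_smul, add_zero] at hTx
    exact hx hTx
  let A : ℕ → GL (Fin (N + 1)) ℂ := fun n =>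
    Matrix.GeneralLinearGroup.mkOfDetNeZero (T n) (hTdet n)
  have hA : ∀ n, W.Preserves (A n) := fun n => h.preserves_of_mem_stabilizer fun x v => by
    change Ω.value ((T n).mulVec x) ((T n).mulVec v) = _
    rw [hT, hT, htrans]
  let a : ℕ → W.autGroup := fun n =>
    ⟨Matrix.ProjGenLinGroup.mk (A n), Subgroup.mem_map_of_mem _ (hA n)⟩
  have ha : Function.Injective a := by
    intro m n hmn
    obtain ⟨c, hc⟩ := Matrix.ProjGenLinGroup.mk_eq_mk_iff.1 (congrArg Subtype.val hmn)
    have hTT : ∀ x : Vec N, c.val • (T m).mulVec x = (T n).mulVec x := by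
      intro x
      have h1 : T m * Matrix.scalar (Fin (N + 1)) c.val = T n := congrArg Units.val hc
      rw [← h1, ← Matrix.mulVec_mulVec, Matrix.scalar_apply, ← Matrix.smul_one_eq_diagonal,
        Matrix.smul_mulVec, Matrix.one_mulVec, Matrix.mulVec_smul]
    have h1 := congrFun (hTT u) i
    rw [hT, hT, hlu] at h1
    simp only [mul_zero, zero_smul, add_zero, Pi.smul_apply, smul_eq_mul] at h1
    have hc1 : c.val = 1 := mul_right_cancel₀ hi (by rw [h1, one_mul])
    have h2 := congrFun (hTT (Pi.single j 1)) i
    rw [hT, hT, hc1, one_smul] at h2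
    simp only [dotProduct_single, hlj, mul_one, Pi.add_apply, Pi.smul_apply, smul_eq_mul,
      add_right_inj] at h2
    have h3 := mul_right_cancel₀ hi (mul_right_cancel₀ hi h2)
    exact_mod_cast h3
  exact not_injective_infinite_finite a ha

theorem IsGlobalForm.value_mulVec_smul (h : IsGlobalForm W Ω δ)
    (M : Matrix (Fin (N + 1)) (Fin (N + 1)) ℂ) (c : ℂ) (x v : Vec N) :
    Ω.value ((c • M).mulVec x) ((c • M).mulVec v) =
      c ^ (δ + k) * Ω.value (M.mulVec x) (M.mulVec v) := by
  rw [Matrix.smul_mulVec, Matrix.smul_mulVec, h.value_smul_left, h.value_smul_right, pow_add,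
    mul_assoc]

theorem val_mul_scalar (B : GL (Fin (N + 1)) ℂ) (t : ℂˣ) :
    (B * Matrix.GeneralLinearGroup.scalar (Fin (N + 1)) t).val = t.val • B.val := by
  rw [Units.val_mul]
  change B.val * Matrix.scalar (Fin (N + 1)) t.val = _
  rw [Matrix.scalar_apply, ← Matrix.smul_one_eq_diagonal, mul_smul_comm, mul_one]

/-- Every automorphism of the web lifts to a matrix which fixes `Ω`. -/
theorem IsGlobalForm.exists_mem_stabilizer (h : IsGlobalForm W Ω δ) (hpos : 0 < δ + k)
    (g : W.autGroup) :
    ∃ A : GL (Fin (N + 1)) ℂ, A.val ∈ Ω.stabilizer ∧ Matrix.ProjGenLinGroup.mk A = g.val := by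
  obtain ⟨g, B, hB, rfl⟩ := g
  obtain ⟨c, hc, hBc⟩ := h.exists_scalar_of_preserves hB
  obtain ⟨t, ht⟩ := IsAlgClosed.exists_pow_nat_eq c⁻¹ hpos
  have ht0 : t ≠ 0 := by
    rintro rfl
    rw [zero_pow hpos.ne'] at ht
    exact inv_ne_zero hc ht.symm
  refine ⟨B * Matrix.GeneralLinearGroup.scalar _ (Units.mk0 t ht0), ?_,
    (Matrix.ProjGenLinGroup.mk_eq_mk_iff.2 ⟨_, rfl⟩).symm⟩
  intro x v
  rw [val_mul_scalar, Units.val_mk0, h.value_mulVec_smul, ht]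
  have := hBc x v
  change Ω.value (B.val.mulVec x) (B.val.mulVec v) = _ at this
  rw [this, inv_mul_cancel_left₀ hc]

/-- The matrices which fix `Ω` are the lifts of the automorphisms of the web, and those of the
same automorphism differ by `(δ + k)`-th roots of unity. -/
theorem IsGlobalForm.nonempty_prod_equiv_stabilizer (hN : 1 ≤ N) (h : IsGlobalForm W Ω δ)
    (hpos : 0 < δ + k) [Finite W.autGroup] :
    Nonempty (W.autGroup × rootsOfUnity (δ + k) ℂ ≃ Ω.stabilizer) := by
  choose s hs hsg using h.exists_mem_stabilizer hpos
  let Φ : W.autGroup × rootsOfUnity (δ + k) ℂ → Ω.stabilizer := fun p =>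
    ⟨(p.2 : ℂˣ).val • (s p.1).val, fun x v => by
      have : ((p.2 : ℂˣ).val) ^ (δ + k) = 1 := by
        have := congrArg Units.val ((mem_rootsOfUnity _ _).1 p.2.2)
        simpa using this
      rw [h.value_mulVec_smul, this, one_mul, hs p.1 x v]⟩
  refine ⟨Equiv.ofBijective Φ ⟨?_, ?_⟩⟩
  · rintro ⟨g, z⟩ ⟨g', z'⟩ heq
    have h1 : (z : ℂˣ).val • (s g).val = (z' : ℂˣ).val • (s g').val := congrArg Subtype.val heq
    have h2 : s g * Matrix.GeneralLinearGroup.scalar (Fin (N + 1)) z =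
        s g' * Matrix.GeneralLinearGroup.scalar (Fin (N + 1)) z' :=
      Units.ext (by rw [val_mul_scalar, val_mul_scalar, h1])
    have h3 := congrArg Matrix.ProjGenLinGroup.mk h2
    rw [map_mul, map_mul, Matrix.ProjGenLinGroup.mk_scalar, Matrix.ProjGenLinGroup.mk_scalar,
      mul_one, mul_one, hsg, hsg] at h3
    obtain rfl := Subtype.ext h3
    have h4 := smul_left_injective ℂ (Units.ne_zero (s g)) h1
    rw [Prod.mk.injEq]
    exact ⟨rfl, Subtype.ext (Units.ext h4)⟩
  · rintro ⟨M, hM⟩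
    let B : GL (Fin (N + 1)) ℂ :=
      Matrix.GeneralLinearGroup.mkOfDetNeZero M (h.det_ne_zero hN hM)
    let g : W.autGroup := ⟨Matrix.ProjGenLinGroup.mk B,
      Subgroup.mem_map_of_mem _ (h.preserves_of_mem_stabilizer (A := B) hM)⟩
    obtain ⟨t, ht⟩ := Matrix.ProjGenLinGroup.mk_eq_mk_iff.1 (hsg g)
    have hval : t.val • (s g).val = M := by rw [← val_mul_scalar, ht]; rfl
    have ht1 : t ∈ rootsOfUnity (δ + k) ℂ := by
      rw [mem_rootsOfUnity]
      obtain ⟨x, v, hxv⟩ := Form.exists_value_ne_zero h.primitive.ne_zero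
      have h1 := hM x v
      rw [← hval, h.value_mulVec_smul, hs g x v] at h1
      exact Units.ext (by simpa using mul_right_cancel₀ hxv (h1.trans (one_mul _).symm))
    exact ⟨(g, ⟨t, ht1⟩), Subtype.ext hval⟩

end

end ProjWeb

theorem proposition3p1 (N k d : ℕ) (hN : 2 ≤ N) (hk : 1 ≤ k) (W : ProjWeb.CodimOneWeb N k)
    (hdeg : W.HasDegree d) (hfin : Finite W.autGroup) :
    Nat.card W.autGroup ≤ (d + 2 * k) ^ ((N + 1) ^ 2 - 1) := by
  obtain ⟨Ω, δ, h⟩ := W.exists_globalForm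
  have hδ : δ + k = d + 2 * k := by
    have := h.degree_eq hk hdeg
    omega
  have hpos : 0 < δ + k := by omega
  have : NeZero (δ + k) := ⟨hpos.ne'⟩
  obtain ⟨Φ⟩ := h.nonempty_prod_equiv_stabilizer (by omega) hpos
  have : Finite Ω.stabilizer := Finite.of_equiv _ Φ
  have hfinS : Ω.stabilizer.Finite := Set.toFinite _
  have h1 := ProjWeb.Form.ncard_stabilizer_le h.coeff_isHomogeneous h.isHomogeneous hpos hfinS
  rw [← Nat.card_coe_set_eq, ← Nat.card_congr Φ, Nat.card_prod, Complex.card_rootsOfUnity] at h1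
  have h2 : (N + 1) ^ 2 = (N + 1) ^ 2 - 1 + 1 := by
    have : 0 < (N + 1) ^ 2 := by positivity
    omega
  rw [h2, pow_succ] at h1
  rw [← hδ]
  exact Nat.le_of_mul_le_mul_right h1 hpos
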